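/- Let $I=(a,b)$ be a bounded open interval, $a<b$, and $\kappa>0$. Let $G_1,\dots,G_R\in\mathbb R^{3\times3}$ be symmetric positive semi-definite, $|y|_{D_r}=(y\cdot G_r y)^{1/2}$, $D=\bigcap_{r=1}^R\{y\in\mathbb R^3: |y|_{D_r}^2\le 1\}$ and $V_D(y)=\sum_{r=1}^R\frac12(|y|_{D_r}-1)_+^2$. Let $L_{bc}:H^2(I;\mathbb R^3)\to\mathbb R^\ell$ be a bounded linear operator realizing boundary conditions, i.e. $L_{bc}[v]$ depends only on $v(a),v(b),v'(a),v'(b)$, let $\ell_{bc}\in\mathbb R^\ell$, and put $$\mathcal A=\{v\in H^2(I;\mathbb R^3): |v'|=1 \text{ a.e.},\ L_{bc}[v]=\ell_{bc}\},$$ and write $v\in\mathcal A\cap D$ if $v\in\mathcal A$ and $v(x)\in D$ for a.e. $x\in I$. Assume $\mathcal A\cap D\neq\emptyset$. Let $E_{bend}[u]=\frac\kappa2\int_I|u''|^2\,dx$ for $u\in\mathcal A\cap D$ and $E_{bend}[u]=+\infty$ for all other $u\in H^2(I;\mathbb R^3)$. For a partition $a=x_0<x_1<\dots<x_N=b$ of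 maximal length $h$, let $V_h$ be the space of globally $C^1$, piecewise cubic splines, let $\mathcal I_{1,h}$ be the continuous piecewise linear nodal interpolation operator, and let $$\mathcal A_h=\{u_h\in V_h^3: |u_h'(x_i)|^2=1,\ i=0,\dots,N,\ L_{bc}[u_h]=\ell_{bc}\}.$$ For $\varepsilon>0$ let $E_{h,\varepsilon}[u]=\frac\kappa2\int_I|u''|^2\,dx+\frac1{2\varepsilon}\int_I\mathcal I_{1,h}V_D(u)\,dx$ for $u\in\mathcal A_h$ and $E_{h,\varepsilon}[u]=+\infty$ for $u\in H^2(I;\mathbb R^3)\setminus\mathcal A_h$. Assume that every minimizer $u\in\mathcal A\cap D$ of $E_{bend}$ belongs to $H^3(I;\mathbb R^3)$, and that either there exists $c>0$ with $\|v\|_{H^2(I)}\le c\|v''\|_{L^2(I)}$ for all $v\in H^2(I;\mathbb R^3)$ with $L_{bc}[v]=0$, or $D$ is bounded. Then discrete almost minimizers accumulate weakly in $H^2(I;\mathbb R^3)$ at minimizers of $E_{bend}$: given any sequence of partitions with maximal lengths $h_n\to0$, any $\varepsilon_n>0$ with $\varepsilon_n\to0$, any real $\delta_n\to0$ and any $u_n\in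 H^2(I;\mathbb R^3)$ with $$E_{h_n,\varepsilon_n}[u_n]\le\inf_{v\in H^2(I;\mathbb R^3)}E_{h_n,\varepsilon_n}[v]+\delta_n\quad\text{for all }n,$$ every subsequence of $(u_n)$ has a further subsequence that converges weakly in $H^2(I;\mathbb R^3)$, and the weak limit of every weakly convergent subsequence of $(u_n)$ belongs to $\mathcal A\cap D$ and minimizes $E_{bend}$. -/

import Mathlib

open Set Filter Topology MeasureTheory
open scoped ContDiff

namespace ConfinedElastica

noncomputable section

/-- The target space of curves, with its Euclidean norm. -/
abbrev E3 : Type := EuclideanSpace ℝ (Fin 3)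

/-! ### Sobolev spaces on the bounded open interval `I = (a, b)` -/

/-- The Lebesgue space `L²(I; ℝ³)`, `I = (a, b)`. -/
abbrev L2 (a b : ℝ) : Type := Lp E3 2 (volume.restrict (Ioo a b))

/-- `g` is the weak derivative of `f` on `I = (a, b)`: `∫ φ' f = - ∫ φ g` for every smooth
scalar test function `φ` with compact support in the open interval. -/
def IsWeakDeriv {a b : ℝ} (f g : L2 a b) : Prop :=
  ∀ φ : ℝ → ℝ, ContDiff ℝ ∞ φ → HasCompactSupport φ → tsupport φ ⊆ Ioo a b →
    ∫ x in Ioo a b, deriv φ x • f x = - ∫ x in Ioo a b, φ x • g x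

theorem integrable_test_smul {a b : ℝ} (f : L2 a b) {ψ : ℝ → ℝ} (hψ : Continuous ψ)
    (hc : HasCompactSupport ψ) :
    Integrable (fun x => ψ x • f x) (volume.restrict (Ioo a b)) := by
  have hf : Integrable (fun x => f x) (volume.restrict (Ioo a b)) :=
    (Lp.memLp f).integrable (by norm_num)
  obtain ⟨C, hC⟩ := hc.exists_bound_of_continuous hψ
  exact hf.bdd_smul C hψ.aestronglyMeasurable (Eventually.of_forall hC)

/-- The Sobolev space `H^k(I; ℝ³)`. An element is the tuple `(u, u', …, u^(k))` of a function in
`L²` and its weak derivatives, all in `L²`; the (weak) derivatives are determined by `u`. The norm is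
`‖u‖² = ∑_{j ≤ k} ‖u^(j)‖²_{L²}`. -/
def Sobolev (k : ℕ) (a b : ℝ) : Submodule ℝ (PiLp 2 (fun _ : Fin (k + 1) => L2 a b)) where
  carrier := {u | ∀ i : Fin k, IsWeakDeriv (u i.castSucc) (u i.succ)}
  zero_mem' := by
    intro i φ _ _ _
    have h : ∀ᵐ x ∂(volume.restrict (Ioo a b)), (0 : L2 a b) x = 0 := Lp.coeFn_zero _ _ _
    have h1 : ∫ x in Ioo a b, deriv φ x • (0 : L2 a b) x = 0 :=
      integral_eq_zero_of_ae (by filter_upwards [h] with x hx; rw [hx, smul_zero]; rfl)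
    have h2 : ∫ x in Ioo a b, φ x • (0 : L2 a b) x = 0 :=
      integral_eq_zero_of_ae (by filter_upwards [h] with x hx; rw [hx, smul_zero]; rfl)
    exact h1.trans (by rw [← neg_zero, ← h2]; rfl)
  add_mem' := by
    intro u v hu hv i φ hφ hc hs
    have key : ∀ (f g : L2 a b) (ψ : ℝ → ℝ), Continuous ψ → HasCompactSupport ψ →
        ∫ x in Ioo a b, ψ x • (f + g : L2 a b) x
          = (∫ x in Ioo a b, ψ x • f x) + ∫ x in Ioo a b, ψ x • g x := by
      intro f g ψ hψ hψc
      rw [← integral_add (integrable_test_smul f hψ hψc) (integrable_test_smul g hψ hψc)]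
      refine integral_congr_ae ?_
      filter_upwards [Lp.coeFn_add f g] with x hx
      rw [hx, Pi.add_apply, smul_add]
    simp only [PiLp.add_apply]
    rw [key _ _ _ (hφ.continuous_deriv (by simp)) hc.deriv, key _ _ _ hφ.continuous hc,
      hu i φ hφ hc hs, hv i φ hφ hc hs, neg_add]
  smul_mem' := by
    intro c u hu i φ hφ hc hs
    have key : ∀ (f : L2 a b) (ψ : ℝ → ℝ),
        ∫ x in Ioo a b, ψ x • (c • f : L2 a b) x = c • ∫ x in Ioo a b, ψ x • f x := by
      intro f ψ
      rw [← integral_smul]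
      refine integral_congr_ae ?_
      filter_upwards [Lp.coeFn_smul c f] with x hx
      simp only [hx, Pi.smul_apply]
      rw [smul_comm]
    simp only [PiLp.smul_apply]
    rw [key, key, hu i φ hφ hc hs, smul_neg]

/-- The space `H²(I; ℝ³)`, a real inner product space. -/
abbrev H2 (a b : ℝ) : Type := Sobolev 2 a b

/-- The function `u ∈ L²` underlying an element of `H²`. -/
def H2.fn {a b : ℝ} (u : H2 a b) : L2 a b := u.1 0

/-- The first weak derivative `u'`. -/
def H2.d1 {a b : ℝ} (u : H2 a b) : L2 a b := u.1 1

/-- The second weak derivative `u''`. -/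
def H2.d2 {a b : ℝ} (u : H2 a b) : L2 a b := u.1 2

/-- `u ∈ H²(I; ℝ³)` belongs to `H³(I; ℝ³)`. -/
def H2.MemH3 {a b : ℝ} (u : H2 a b) : Prop := ∃ w : Sobolev 3 a b, w.1 0 = u.fn

/-- Weak convergence in `H²(I; ℝ³)`. -/
def WeakConv {a b : ℝ} (u : ℕ → H2 a b) (u₀ : H2 a b) : Prop :=
  ∀ F : H2 a b →L[ℝ] ℝ, Tendsto (fun n => F (u n)) atTop (𝓝 (F u₀))

/-- `f` is a representative of `u` that is continuously differentiable on `[a, b]`. -/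
def H2.IsC1Rep {a b : ℝ} (u : H2 a b) (f : ℝ → E3) : Prop :=
  ContDiffOn ℝ 1 f (Icc a b) ∧ u.fn =ᵐ[volume.restrict (Ioo a b)] f

open Classical in
/-- The continuously differentiable representative of `u`; its values on `[a, b]` are unique. It is
used only on spline functions, for which the representative exists by definition. -/
def H2.c1Rep {a b : ℝ} (u : H2 a b) : ℝ → E3 :=
  if h : ∃ f, u.IsC1Rep f then h.choose else 0

/-- The derivative at `x ∈ [a, b]` of the representative (one-sided at the end points). -/
def H2.c1Deriv {a b : ℝ} (u : H2 a b) (x : ℝ) : E3 := derivWithin u.c1Rep (Icc a b) x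

/-- The bounded linear operator `L` realizes boundary conditions: `L v` depends only on
`v(a), v(b), v'(a), v'(b)`. By linearity this means that `L v = 0` whenever these four
vectors vanish. -/
def IsBoundaryOperator {a b : ℝ} {l : ℕ} (L : H2 a b →L[ℝ] EuclideanSpace ℝ (Fin l)) : Prop :=
  ∀ (v : H2 a b) (f : ℝ → E3), v.IsC1Rep f → f a = 0 → f b = 0 →
    derivWithin f (Icc a b) a = 0 → derivWithin f (Icc a b) b = 0 → L v = 0

/-! ### Composite quadratic confinements -/

/-- The seminorm `|y|_D = (y · G y)^{1/2}`. -/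
def confNorm (G : Matrix (Fin 3) (Fin 3) ℝ) (y : E3) : ℝ :=
  Real.sqrt (y.ofLp ⬝ᵥ (G.mulVec y.ofLp))

/-- The composite quadratic confinement `D = ⋂_r {y | y · G_r y ≤ 1}`. -/
def confinement {R : ℕ} (G : Fin R → Matrix (Fin 3) (Fin 3) ℝ) : Set E3 :=
  {y | ∀ r, y.ofLp ⬝ᵥ ((G r).mulVec y.ofLp) ≤ 1}

/-- The potential `V_D(y) = ∑_r ½ (|y|_{D_r} - 1)₊²`. -/
def potential {R : ℕ} (G : Fin R → Matrix (Fin 3) (Fin 3) ℝ) (y : E3) : ℝ :=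
  ∑ r, (1 / 2 : ℝ) * (max (confNorm (G r) y - 1) 0) ^ 2

/-! ### The continuous problem -/

/-- `𝒜 = {v ∈ H² : |v'| = 1 a.e., L_bc v = ℓ_bc}`. -/
def admissible {a b : ℝ} {l : ℕ} (L : H2 a b →L[ℝ] EuclideanSpace ℝ (Fin l))
    (β : EuclideanSpace ℝ (Fin l)) : Set (H2 a b) :=
  {v | (∀ᵐ x ∂(volume.restrict (Ioo a b)), ‖v.d1 x‖ = 1) ∧ L v = β}

/-- `𝒜 ∩ D`: the admissible curves with values in `D`. -/
def admissibleIn {a b : ℝ} {R l : ℕ} (G : Fin R → Matrix (Fin 3) (Fin 3) ℝ)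
    (L : H2 a b →L[ℝ] EuclideanSpace ℝ (Fin l)) (β : EuclideanSpace ℝ (Fin l)) :
    Set (H2 a b) :=
  {v | v ∈ admissible L β ∧ ∀ᵐ x ∂(volume.restrict (Ioo a b)), v.fn x ∈ confinement G}

open Classical in
/-- `E_bend[u] = (κ/2) ∫ |u''|²` on `𝒜 ∩ D`, and `+∞` elsewhere in `H²`. -/
def bendEnergy {a b : ℝ} {R l : ℕ} (κ : ℝ) (G : Fin R → Matrix (Fin 3) (Fin 3) ℝ)
    (L : H2 a b →L[ℝ] EuclideanSpace ℝ (Fin l)) (β : EuclideanSpace ℝ (Fin l))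
    (u : H2 a b) : EReal :=
  if u ∈ admissibleIn G L β then ((κ / 2 * ∫ x in Ioo a b, ‖u.d2 x‖ ^ 2 : ℝ) : EReal) else ⊤

/-- `u ∈ 𝒜 ∩ D` is a minimizer of `E_bend`. -/
def IsBendMinimizer {a b : ℝ} {R l : ℕ} (κ : ℝ) (G : Fin R → Matrix (Fin 3) (Fin 3) ℝ)
    (L : H2 a b →L[ℝ] EuclideanSpace ℝ (Fin l)) (β : EuclideanSpace ℝ (Fin l))
    (u : H2 a b) : Prop :=
  u ∈ admissibleIn G L β ∧ ∀ v, bendEnergy κ G L β u ≤ bendEnergy κ G L β v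

/-! ### The discrete problem -/

/-- A partition `a = x_0 < x_1 < … < x_N = b`. -/
structure Partition (a b : ℝ) where
  N : ℕ
  node : Fin (N + 1) → ℝ
  strictMono : StrictMono node
  node_zero : node 0 = a
  node_last : node (Fin.last N) = b

/-- The maximal length `h` of the subintervals. -/
def Partition.mesh {a b : ℝ} (P : Partition a b) : ℝ :=
  ⨆ i : Fin P.N, (P.node i.succ - P.node i.castSucc)

theorem sum_telescope {N : ℕ} (F : Fin (N + 1) → ℝ) (i : Fin (N + 1)) :
    ∑ j : Fin N, (if j.castSucc < i then F j.succ - F j.castSucc else 0) = F i - F 0 := by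
  induction i using Fin.induction with
  | zero => simp
  | succ i ih =>
    have h : ∀ j : Fin N, (if j.castSucc < i.succ then F j.succ - F j.castSucc else 0)
        = (if j.castSucc < i.castSucc then F j.succ - F j.castSucc else 0)
          + (if j = i then F j.succ - F j.castSucc else 0) := by
      intro j
      have h1 : j.castSucc < i.succ ↔ j.val ≤ i.val := by
        rw [Fin.lt_def, Fin.val_succ, Fin.val_castSucc, Nat.lt_succ_iff]
      have h2 : j.castSucc < i.castSucc ↔ j.val < i.val := Fin.castSucc_lt_castSucc_iff.trans Fin.lt_def
      have h3 : j = i ↔ j.val = i.val := Fin.ext_iff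
      simp only [h1, h2, h3]
      rcases lt_trichotomy j.val i.val with h | h | h
      · simp [h, h.le, h.ne]
      · simp [h]
      · simp [h.not_ge, h.not_gt, h.ne']
    rw [Finset.sum_congr rfl (fun j _ => h j), Finset.sum_add_distrib, ih,
      Finset.sum_ite_eq' Finset.univ i]
    simp

/-- The nodal interpolant `I_{1,h} g`: the continuous function that is affine on every
`[x_i, x_{i+1}]` and agrees with `g` at the nodes (see `interp_eq`), written as
`g(x_0) + ∑_i (g(x_{i+1}) - g(x_i)) θ_i(x)`, where `θ_i` rises linearly from `0` to `1` on
`[x_i, x_{i+1}]`. -/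
def Partition.interp {a b : ℝ} (P : Partition a b) (g : ℝ → ℝ) (x : ℝ) : ℝ :=
  g (P.node 0) + ∑ i : Fin P.N, (g (P.node i.succ) - g (P.node i.castSucc)) *
    max 0 (min 1 ((x - P.node i.castSucc) / (P.node i.succ - P.node i.castSucc)))

theorem Partition.interp_eq {a b : ℝ} (P : Partition a b) (g : ℝ → ℝ) (i : Fin P.N) {x : ℝ}
    (hx : x ∈ Icc (P.node i.castSucc) (P.node i.succ)) :
    P.interp g x = g (P.node i.castSucc) + (g (P.node i.succ) - g (P.node i.castSucc)) *
      ((x - P.node i.castSucc) / (P.node i.succ - P.node i.castSucc)) := by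
  have hlt : ∀ j : Fin P.N, 0 < P.node j.succ - P.node j.castSucc := fun j =>
    sub_pos.2 (P.strictMono Fin.castSucc_lt_succ)
  have h : ∀ j : Fin P.N, (g (P.node j.succ) - g (P.node j.castSucc)) *
      max 0 (min 1 ((x - P.node j.castSucc) / (P.node j.succ - P.node j.castSucc)))
      = (if j.castSucc < i.castSucc then g (P.node j.succ) - g (P.node j.castSucc) else 0)
        + (if j = i then (g (P.node j.succ) - g (P.node j.castSucc)) *
          ((x - P.node j.castSucc) / (P.node j.succ - P.node j.castSucc)) else 0) := by
    intro j
    rcases lt_trichotomy j i with hj | hj | hj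
    · have hle : P.node j.succ ≤ P.node i.castSucc := P.strictMono.monotone (by
        simp only [Fin.le_def, Fin.val_succ, Fin.val_castSucc]; exact hj)
      have h1 : 1 ≤ (x - P.node j.castSucc) / (P.node j.succ - P.node j.castSucc) := by
        rw [le_div_iff₀ (hlt j)]; linarith [hx.1]
      rw [min_eq_left h1, max_eq_right zero_le_one,
        if_pos (Fin.castSucc_lt_castSucc_iff.2 hj), if_neg hj.ne]
      ring
    · subst hj
      have h0 : 0 ≤ (x - P.node j.castSucc) / (P.node j.succ - P.node j.castSucc) :=
        div_nonneg (sub_nonneg.2 hx.1) (hlt j).le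
      have h1 : (x - P.node j.castSucc) / (P.node j.succ - P.node j.castSucc) ≤ 1 := by
        rw [div_le_one (hlt j)]; linarith [hx.2]
      rw [min_eq_right h1, max_eq_right h0]
      simp
    · have hle : P.node i.succ ≤ P.node j.castSucc := P.strictMono.monotone (by
        simp only [Fin.le_def, Fin.val_succ, Fin.val_castSucc]; exact hj)
      have h1 : (x - P.node j.castSucc) / (P.node j.succ - P.node j.castSucc) ≤ 0 :=
        div_nonpos_of_nonpos_of_nonneg (by linarith [hx.2]) (hlt j).le
      rw [max_eq_left ((min_le_right _ _).trans h1),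
        if_neg (fun hc => (Fin.castSucc_lt_castSucc_iff.1 hc).not_gt hj), if_neg hj.ne']
      ring
  unfold Partition.interp
  rw [Finset.sum_congr rfl (fun j _ => h j), Finset.sum_add_distrib,
    sum_telescope (fun k => g (P.node k)), Finset.sum_ite_eq' Finset.univ i]
  simp only [Finset.mem_univ, if_true]
  ring

/-- `s` is a continuously differentiable piecewise cubic spline (with values in `ℝ³`). -/
def IsCubicSpline {a b : ℝ} (P : Partition a b) (s : ℝ → E3) : Prop :=
  ContDiffOn ℝ 1 s (Icc a b) ∧
    ∀ i : Fin P.N, ∃ c : Fin 4 → E3,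
      ∀ x ∈ Icc (P.node i.castSucc) (P.node i.succ), s x = ∑ j : Fin 4, x ^ (j : ℕ) • c j

/-- The spline space `V_h³ ⊆ H²(I; ℝ³)`. -/
def splineSpace {a b : ℝ} (P : Partition a b) : Set (H2 a b) :=
  {u | ∃ s, IsCubicSpline P s ∧ u.fn =ᵐ[volume.restrict (Ioo a b)] s}

/-- `𝒜_h = {u_h ∈ V_h³ : |u_h'(x_i)|² = 1 for all i, L_bc u_h = ℓ_bc}`. -/
def discreteAdmissible {a b : ℝ} {l : ℕ} (P : Partition a b)
    (L : H2 a b →L[ℝ] EuclideanSpace ℝ (Fin l)) (β : EuclideanSpace ℝ (Fin l)) :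
    Set (H2 a b) :=
  {u | u ∈ splineSpace P ∧ (∀ i, ‖u.c1Deriv (P.node i)‖ ^ 2 = 1) ∧ L u = β}

open Classical in
/-- `E_{h,ε}[u] = (κ/2) ∫ |u''|² + (1/(2ε)) ∫ I_{1,h} V_D(u)` on `𝒜_h`, and `+∞` elsewhere in
`H²`. -/
def discreteEnergy {a b : ℝ} {R l : ℕ} (κ : ℝ) (G : Fin R → Matrix (Fin 3) (Fin 3) ℝ)
    (L : H2 a b →L[ℝ] EuclideanSpace ℝ (Fin l)) (β : EuclideanSpace ℝ (Fin l))
    (P : Partition a b) (ε : ℝ) (u : H2 a b) : EReal :=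
  if u ∈ discreteAdmissible P L β then
    ((κ / 2 * (∫ x in Ioo a b, ‖u.d2 x‖ ^ 2)
      + 1 / (2 * ε) * ∫ x in Ioo a b, P.interp (fun y => potential G (u.c1Rep y)) x : ℝ) : EReal)
  else ⊤

end

end ConfinedElastica

open ConfinedElastica

namespace ConfinedElastica

noncomputable section

/-! ### Primitives of `L²` functions -/

/-! The argument is a Γ-convergence proof whose recovery sequence has no error term. For `v` in 𝒜 ∩
D let `s` be its cubic Hermite interpolant, which shares the values and slopes of `v` at all nodes.
Then `s` satisfies the nodal constraint and the boundary conditions, and its penalty is zero because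
the interpolated potential sees only nodal values. Moreover `s''` is the L² projection of `v''` onto
discontinuous piecewise affine functions, so the bending energy does not grow. Hence the infimum of
E_{h,ε} is at most E_bend[v] for every partition and every ε (`exists_discreteEnergy_le`), and h and
ε need not be coupled.

Almost minimizers therefore have bending energy at most E_bend[v] + δ_n for every competitor `v`,
and a penalty integral of order ε_n. Either coercivity alternative then bounds them in H²
(`exists_norm_le_of_energy_le`), and Hilbert space compactness gives weak limits.

Point evaluations of `u` and `u'` are bounded functionals on H², and bounded sets are equicontinuous
together with their first derivatives. Evaluating at nodes that approach a given point thus carries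
the constraint |u'| = 1 to the limit, and Fatou's lemma shows that the potential of the limit
vanishes (`mem_admissibleIn_of_weakConv`). Weak lower semicontinuity of the norm
(`WeakConv.energy_le`) gives minimality. -/

/-- Fubini on the triangle a < t < x < b. It serves as integration by parts for primitives of merely
integrable functions, and later turns a double integral of `w''` into moments. -/
theorem integral_smul_primitive {E : Type*} [NormedAddCommGroup E] [NormedSpace ℝ E]
    [CompleteSpace E] {a b : ℝ} {ψ : ℝ → ℝ} {g : ℝ → E} (hψ : IntegrableOn ψ (Ioo a b)) (hg : IntegrableOn g (Ioo a b)) :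
    ∫ x in Ioo a b, ψ x • ∫ t in a..x, g t = ∫ t in Ioo a b, (∫ x in t..b, ψ x) • g t := by
  have hswap : ∀ x t, ψ x • (Iio x).indicator g t = (Ioi t).indicator ψ x • g t := by
    intro x t
    by_cases h : t < x
    · simp [indicator_of_mem (show t ∈ Iio x from h), indicator_of_mem (show x ∈ Ioi t from h)]
    · simp [indicator_of_notMem (show t ∉ Iio x from h), indicator_of_notMem (show x ∉ Ioi t from h)]
  have hint : Integrable (Function.uncurry fun x t => ψ x • (Iio x).indicator g t)
      ((volume.restrict (Ioo a b)).prod (volume.restrict (Ioo a b))) := by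
    have h1 : Integrable (fun p : ℝ × ℝ => ψ p.1 • g p.2)
        ((volume.restrict (Ioo a b)).prod (volume.restrict (Ioo a b))) := hψ.smul_prod hg
    have h2 := h1.indicator (measurableSet_lt measurable_snd measurable_fst :
      MeasurableSet {p : ℝ × ℝ | p.2 < p.1})
    refine h2.congr (Eventually.of_forall fun p => ?_)
    by_cases h : p.2 < p.1
    · simp [indicator, Function.uncurry, h]
    · simp [indicator, Function.uncurry, h]
  have h1 : ∀ x ∈ Ioo a b, ψ x • ∫ t in a..x, g t
      = ∫ t in Ioo a b, ψ x • (Iio x).indicator g t := by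
    intro x hx
    rw [integral_smul, setIntegral_indicator measurableSet_Iio,
      intervalIntegral.integral_of_le hx.1.le, integral_Ioc_eq_integral_Ioo, Ioo_inter_Iio,
      min_eq_right hx.2.le]
  have h2 : ∀ t ∈ Ioo a b, (∫ x in t..b, ψ x) • g t
      = ∫ x in Ioo a b, ψ x • (Iio x).indicator g t := by
    intro t ht
    simp_rw [hswap]
    rw [integral_smul_const, setIntegral_indicator measurableSet_Ioi,
      intervalIntegral.integral_of_le ht.2.le, integral_Ioc_eq_integral_Ioo, Ioo_inter_Ioi,
      max_eq_right ht.1.le]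
  rw [setIntegral_congr_fun measurableSet_Ioo h1, setIntegral_congr_fun measurableSet_Ioo h2]
  exact integral_integral_swap hint

theorem L2.integrableOn {a b : ℝ} (g : L2 a b) : IntegrableOn g (Ioo a b) :=
  (Lp.memLp g).integrable (by norm_num)

theorem L2.intervalIntegrable {a b : ℝ} (g : L2 a b) {x y : ℝ} (hx : x ∈ Icc a b)
    (hy : y ∈ Icc a b) : IntervalIntegrable g volume x y := by
  rw [intervalIntegrable_iff]
  have h : IntegrableOn g (Ioc a b) :=
    (integrableOn_Ioc_iff_integrableOn_Ioo).2 (L2.integrableOn g)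
  refine h.mono_set ?_
  rw [uIoc]
  exact Ioc_subset_Ioc (le_min hx.1 hy.1) (max_le hx.2 hy.2)

/-- Cauchy–Schwarz on `s`. On intervals this is the source of the ½-Hölder bound for slopes. -/
theorem L2.setIntegral_norm_le {a b : ℝ} (g : L2 a b) {s : Set ℝ} (hs : s ⊆ Ioo a b) :
    ∫ t in s, ‖g t‖ ≤ Real.sqrt (volume.real s) * ‖g‖ := by
  have hm : AEStronglyMeasurable g (volume.restrict s) :=
    (g.integrableOn.mono_set hs).aestronglyMeasurable
  have hfin : volume s ≠ ⊤ := ((measure_mono hs).trans_lt measure_Ioo_lt_top).ne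
  have h1 := eLpNorm_le_eLpNorm_mul_rpow_measure_univ (μ := volume.restrict s) (p := 1) (q := 2)
    (by norm_num) hm
  have h2 : eLpNorm g 2 (volume.restrict s) ≤ eLpNorm g 2 (volume.restrict (Ioo a b)) :=
    eLpNorm_mono_measure _ (Measure.restrict_mono_set _ hs)
  have h3 := h1.trans (mul_le_mul_left h2 _)
  rw [integral_norm_eq_lintegral_enorm hm, ← eLpNorm_one_eq_lintegral_enorm, Lp.norm_def]
  refine (ENNReal.toReal_mono ?_ h3).trans_eq ?_
  · refine ENNReal.mul_ne_top (Lp.memLp g).2.ne (ENNReal.rpow_ne_top_of_nonneg (by norm_num) ?_)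
    simpa using hfin
  · rw [ENNReal.toReal_mul, mul_comm, Real.sqrt_eq_rpow, Measure.restrict_apply_univ,
      ← ENNReal.toReal_rpow]
    norm_num [Measure.real]

theorem L2.norm_intervalIntegral_le {a b : ℝ} (g : L2 a b) {x y : ℝ} (hx : x ∈ Icc a b)
    (hy : y ∈ Icc a b) : ‖∫ t in x..y, g t‖ ≤ Real.sqrt |y - x| * ‖g‖ := by
  wlog h : x ≤ y generalizing x y
  · rw [intervalIntegral.integral_symm, norm_neg, abs_sub_comm]
    exact this hy hx (le_of_not_ge h)
  rw [intervalIntegral.integral_of_le h, integral_Ioc_eq_integral_Ioo]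
  refine (norm_integral_le_integral_norm _).trans
    ((g.setIntegral_norm_le (Ioo_subset_Ioo hx.1 hy.2)).trans_eq ?_)
  rw [Real.volume_real_Ioo_of_le h, abs_of_nonneg (sub_nonneg.2 h)]


/-! ### Functions with vanishing weak derivative -/

theorem eq_zero_of_tsupport_subset {U : Set ℝ} {φ : ℝ → ℝ} (h : tsupport φ ⊆ U) {x : ℝ}
    (hx : x ∉ U) : φ x = 0 :=
  image_eq_zero_of_notMem_tsupport fun hc => hx (h hc)

/-- The primitive of `η` from `a` vanishes to the left of the support trivially and to the right of
it because the mean is zero. Its support lies in the smallest closed interval containing that of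
`η`, which is still inside (a, b). -/
theorem exists_test_deriv {a b : ℝ} {η : ℝ → ℝ} (hη : ContDiff ℝ ∞ η) (hc : HasCompactSupport η)
    (hs : tsupport η ⊆ Ioo a b) (h0 : ∫ x in a..b, η x = 0) :
    ∃ φ : ℝ → ℝ, ContDiff ℝ ∞ φ ∧ HasCompactSupport φ ∧ tsupport φ ⊆ Ioo a b ∧ deriv φ = η := by
  rcases (tsupport η).eq_empty_or_nonempty with he | hne
  · refine ⟨0, contDiff_const, HasCompactSupport.zero, by simp [tsupport], ?_⟩
    rw [tsupport_eq_empty_iff] at he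
    rw [he]; ext x; simp
  obtain ⟨α, hα, hαl⟩ := hc.exists_isLeast hne
  obtain ⟨β, hβ, hβl⟩ := hc.exists_isGreatest hne
  have hαI := hs hα
  have hβI := hs hβ
  have hout : ∀ x, x ∉ Icc α β → η x = 0 := fun x hx =>
    image_eq_zero_of_notMem_tsupport fun hxs => hx ⟨hαl hxs, hβl hxs⟩
  have hint : ∀ x y, IntervalIntegrable η volume x y := fun x y => hη.continuous.intervalIntegrable _ _
  have hder : ∀ x, HasDerivAt (fun x => ∫ t in a..x, η t) (η x) x := fun x =>
    intervalIntegral.integral_hasDerivAt_right (hint _ _)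
      hη.continuous.stronglyMeasurable.stronglyMeasurableAtFilter hη.continuous.continuousAt
  have hd : deriv (fun x => ∫ t in a..x, η t) = η := funext fun x => (hder x).deriv
  have hsub : Function.support (fun x => ∫ t in a..x, η t) ⊆ Icc α β := by
    intro x hx
    by_contra hxn
    apply hx
    show ∫ t in a..x, η t = 0
    rcases lt_or_ge x α with h | h
    · refine intervalIntegral.integral_zero_ae (Eventually.of_forall fun t ht => hout t ?_)
      rintro ⟨h1, -⟩
      exact absurd h1 (not_le.2 (ht.2.trans_lt (max_lt hαI.1 h)))
    · have h' : β < x := lt_of_not_ge fun h2 => hxn ⟨h, h2⟩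
      rw [← intervalIntegral.integral_add_adjacent_intervals (hint a b) (hint b x), h0, zero_add]
      refine intervalIntegral.integral_zero_ae (Eventually.of_forall fun t ht => hout t ?_)
      rintro ⟨-, h1⟩
      exact absurd h1 (not_le.2 ((lt_min hβI.2 h').trans ht.1))
  have hts : tsupport (fun x => ∫ t in a..x, η t) ⊆ Icc α β := closure_minimal hsub isClosed_Icc
  refine ⟨fun x => ∫ t in a..x, η t, ?_, isCompact_Icc.of_isClosed_subset isClosed_closure hts,
    hts.trans (Icc_subset_Ioo hαI.1 hβI.2), hd⟩
  exact contDiff_infty_iff_deriv.2 ⟨fun x => (hder x).differentiableAt, by rwa [hd]⟩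

theorem exists_test_integral_eq_one {a b : ℝ} (hab : a < b) :
    ∃ ψ : ℝ → ℝ, ContDiff ℝ ∞ ψ ∧ HasCompactSupport ψ ∧ tsupport ψ ⊆ Ioo a b ∧
      ∫ x, ψ x = 1 := by
  let B : ContDiffBump ((a + b) / 2) := ⟨(b - a) / 8, (b - a) / 4, by linarith, by linarith⟩
  refine ⟨B.normed volume, B.contDiff_normed, B.hasCompactSupport_normed, ?_, B.integral_normed⟩
  rw [B.tsupport_normed_eq, Real.closedBall_eq_Icc]
  exact Icc_subset_Ioo (by show a < (a + b) / 2 - (b - a) / 4; linarith)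
    (by show (a + b) / 2 + (b - a) / 4 < b; linarith)

theorem setIntegral_test_smul {E : Type*} [NormedAddCommGroup E] [NormedSpace ℝ E] {U : Set ℝ}
    {φ : ℝ → ℝ} (hs : tsupport φ ⊆ U) (f : ℝ → E) :
    ∫ x in U, φ x • f x = ∫ x, φ x • f x :=
  setIntegral_eq_integral_of_forall_compl_eq_zero fun x hx => by
    rw [eq_zero_of_tsupport_subset hs hx, zero_smul]

/-- Du Bois-Reymond's lemma. With `ψ` of integral 1 and m = ∫ φ, the function φ − mψ has mean zero,
hence is the derivative of a test function. So ∫ φ f = m ∫ ψ f for every `φ`, which forces f = ∫ ψ f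
almost everywhere. -/
theorem ae_const_of_integral_deriv_smul_eq_zero {a b : ℝ} (hab : a < b) {f : ℝ → E3}
    (hf : IntegrableOn f (Ioo a b))
    (h : ∀ φ : ℝ → ℝ, ContDiff ℝ ∞ φ → HasCompactSupport φ → tsupport φ ⊆ Ioo a b →
      ∫ x in Ioo a b, deriv φ x • f x = 0) :
    ∃ c : E3, f =ᵐ[volume.restrict (Ioo a b)] fun _ => c := by
  obtain ⟨ψ, hψ, hψc, hψs, hψ1⟩ := exists_test_integral_eq_one hab
  have hint : ∀ φ : ℝ → ℝ, Continuous φ → HasCompactSupport φ →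
      IntegrableOn (fun x => φ x • f x) (Ioo a b) := fun φ hφ hφc => by
    obtain ⟨C, hC⟩ := hφc.exists_bound_of_continuous hφ
    exact hf.bdd_smul C hφ.aestronglyMeasurable (Eventually.of_forall hC)
  refine ⟨∫ x in Ioo a b, ψ x • f x, ?_⟩
  have hli : LocallyIntegrableOn (fun x => f x - ∫ x in Ioo a b, ψ x • f x) (Ioo a b) volume :=
    (hf.sub (integrableOn_const (by simp))).locallyIntegrableOn
  have key := isOpen_Ioo.ae_eq_zero_of_integral_contDiff_smul_eq_zero hli ?_
  · filter_upwards [(ae_restrict_iff' measurableSet_Ioo).2 key] with x hx using sub_eq_zero.1 hx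
  intro φ hφ hφc hφs
  set m := ∫ x, φ x with hm
  have hηs : tsupport (fun x => φ x - m * ψ x) ⊆ Ioo a b := by
    refine (closure_minimal ?_ ((isClosed_tsupport φ).union (isClosed_tsupport ψ))).trans
      (union_subset hφs hψs)
    intro x hx
    by_contra hc
    rw [mem_union, not_or] at hc
    exact hx (by simp [image_eq_zero_of_notMem_tsupport hc.1, image_eq_zero_of_notMem_tsupport hc.2])
  have hηc : HasCompactSupport (fun x => φ x - m * ψ x) := hφc.sub (hψc.mul_left)
  have hI : ∀ χ : ℝ → ℝ, tsupport χ ⊆ Ioo a b → ∫ x in a..b, χ x = ∫ x, χ x := by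
    intro χ hχ
    rw [intervalIntegral.integral_of_le hab.le, integral_Ioc_eq_integral_Ioo]
    exact setIntegral_eq_integral_of_forall_compl_eq_zero fun x hx =>
      eq_zero_of_tsupport_subset hχ hx
  have hφi : Integrable φ := hφ.continuous.integrable_of_hasCompactSupport hφc
  have hψi : Integrable ψ := hψ.continuous.integrable_of_hasCompactSupport hψc
  obtain ⟨Φ, hΦ, hΦc, hΦs, hΦd⟩ := exists_test_deriv (hφ.sub (contDiff_const.mul hψ)) hηc hηs (by
    rw [hI _ hηs, integral_sub hφi (hψi.const_mul _), integral_const_mul, hψ1, mul_one, sub_self])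
  have h0 := h Φ hΦ hΦc hΦs
  rw [hΦd] at h0
  have e1 : ∫ x in Ioo a b, (φ x - m * ψ x) • f x
      = (∫ x in Ioo a b, φ x • f x) - m • ∫ x in Ioo a b, ψ x • f x := by
    rw [← integral_smul]
    refine Eq.trans ?_ (integral_sub (hint φ hφ.continuous hφc)
      ((hint ψ hψ.continuous hψc).smul m))
    simp only [sub_smul, mul_smul]
  rw [e1] at h0
  rw [← setIntegral_test_smul hφs]
  simp only [smul_sub]
  rw [integral_sub (hint φ hφ.continuous hφc) ((hφi.integrableOn).smul_const _),
    integral_smul_const]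
  rw [show ∫ x in Ioo a b, φ x = m from by
    rw [← integral_Ioc_eq_integral_Ioo, ← intervalIntegral.integral_of_le hab.le, hI φ hφs], h0]

/-- Fubini replaces φ' by its integral over (t, b), which is −φ(t). The constant drops out since φ
vanishes at both ends. -/
theorem integral_deriv_smul_primitive {a b : ℝ} (hab : a < b) {g : ℝ → E3}
    (hg : IntegrableOn g (Ioo a b)) (c : E3) {φ : ℝ → ℝ} (hφ : ContDiff ℝ ∞ φ)
    (hc : HasCompactSupport φ) (hs : tsupport φ ⊆ Ioo a b) :
    ∫ x in Ioo a b, deriv φ x • (c + ∫ t in a..x, g t) = - ∫ x in Ioo a b, φ x • g x := by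
  have hd : Continuous (deriv φ) := hφ.continuous_deriv (by simp)
  have hdi : IntegrableOn (deriv φ) (Ioo a b) :=
    (hd.integrable_of_hasCompactSupport hc.deriv).integrableOn
  have hφb : φ b = 0 := eq_zero_of_tsupport_subset hs (by simp)
  have hφa : φ a = 0 := eq_zero_of_tsupport_subset hs (by simp)
  have hftc : ∀ t, ∫ x in t..b, deriv φ x = - φ t := fun t => by
    rw [intervalIntegral.integral_deriv_eq_sub
      (fun x _ => (hφ.differentiable (by simp)) x) (hd.intervalIntegrable _ _), hφb, zero_sub]
  have hcont : ContinuousOn (fun x => ∫ t in a..x, g t) (Icc a b) := by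
    have := intervalIntegral.continuousOn_primitive_interval (μ := volume) (f := g) (a := a) (b := b)
      (by rw [uIcc_of_le hab.le]; exact (integrableOn_Icc_iff_integrableOn_Ioo).2 hg)
    rwa [uIcc_of_le hab.le] at this
  have hi2 : IntegrableOn (fun x => deriv φ x • ∫ t in a..x, g t) (Ioo a b) :=
    ((hd.continuousOn.smul hcont).integrableOn_Icc).mono_set Ioo_subset_Icc_self
  simp only [smul_add]
  rw [integral_add (hdi.smul_const c) hi2, integral_smul_const, integral_smul_primitive hdi hg,
    ← integral_Ioc_eq_integral_Ioo, ← intervalIntegral.integral_of_le hab.le, hftc, hφa]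
  simp only [hftc, neg_smul, integral_neg, neg_zero, zero_smul, zero_add]

/-! ### The continuously differentiable representative of an `H²` function -/

theorem L2.continuousOn_primitive {a b : ℝ} (g : L2 a b) (hab : a ≤ b) :
    ContinuousOn (fun x => ∫ t in a..x, g t) (Icc a b) := by
  have := intervalIntegral.continuousOn_primitive_interval (μ := volume) (f := g) (a := a) (b := b)
    (by rw [uIcc_of_le hab]; exact (integrableOn_Icc_iff_integrableOn_Ioo).2 (L2.integrableOn g))
  rwa [uIcc_of_le hab] at this

theorem exists_primitive_of_isWeakDeriv {a b : ℝ} (hab : a < b) {f g : L2 a b}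
    (h : IsWeakDeriv f g) :
    ∃ c : E3, f =ᵐ[volume.restrict (Ioo a b)] fun x => c + ∫ t in a..x, g t := by
  have hcont := g.continuousOn_primitive hab.le
  have hpi : IntegrableOn (fun x => ∫ t in a..x, g t) (Ioo a b) :=
    hcont.integrableOn_Icc.mono_set Ioo_subset_Icc_self
  obtain ⟨c, hc⟩ := ae_const_of_integral_deriv_smul_eq_zero hab
    (f := fun x => f x - ∫ t in a..x, g t) ((L2.integrableOn f).sub hpi) (by
      intro φ hφ hφc hφs
      have hd : Continuous (deriv φ) := hφ.continuous_deriv (by simp)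
      have hdc := hφc.deriv
      obtain ⟨C, hC⟩ := hdc.exists_bound_of_continuous hd
      have h1 := integral_deriv_smul_primitive hab (L2.integrableOn g) 0 hφ hφc hφs
      simp only [zero_add] at h1
      simp only [smul_sub]
      refine (integral_sub (integrable_test_smul f hd hdc)
        (hpi.bdd_smul C hd.aestronglyMeasurable (Eventually.of_forall hC))).trans ?_
      exact sub_eq_zero.2 ((h φ hφ hφc hφs).trans h1.symm))
  refine ⟨c, ?_⟩
  filter_upwards [hc] with x hx
  rw [← hx, sub_add_cancel]

theorem H2.exists_init {a b : ℝ} (hab : a < b) (u : H2 a b) :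
    ∃ p q : E3, (u.d1 =ᵐ[volume.restrict (Ioo a b)] fun x => q + ∫ t in a..x, u.d2 t) ∧
      u.fn =ᵐ[volume.restrict (Ioo a b)] fun x => p + ∫ y in a..x, (q + ∫ t in a..y, u.d2 t) := by
  obtain ⟨q, hq⟩ := exists_primitive_of_isWeakDeriv hab (u.2 1)
  obtain ⟨p, hp⟩ := exists_primitive_of_isWeakDeriv hab (u.2 0)
  refine ⟨p, q, hq, ?_⟩
  filter_upwards [hp, ae_restrict_mem measurableSet_Ioo] with x hx hxI
  refine hx.trans ?_
  congr 1
  refine intervalIntegral.integral_congr_ae ?_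
  have hq' := (ae_restrict_iff' measurableSet_Ioo).1 hq
  filter_upwards [hq', (measure_eq_zero_iff_ae_notMem.1 (measure_singleton x) :
    ∀ᵐ y ∂volume, y ∉ ({x} : Set ℝ))] with y hy hyx hyI
  rw [uIoc_of_le hxI.1.le] at hyI
  exact hy ⟨hyI.1, lt_of_le_of_ne (hyI.2.trans hxI.2.le) fun h => by linarith [hyI.2, hxI.2]⟩

/-- The value at `a` of the continuous representative of `u`. -/
def H2.initVal {a b : ℝ} (u : H2 a b) : E3 := Classical.epsilon fun p => ∃ q : E3,
  (u.d1 =ᵐ[volume.restrict (Ioo a b)] fun x => q + ∫ t in a..x, u.d2 t) ∧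
    u.fn =ᵐ[volume.restrict (Ioo a b)] fun x => p + ∫ y in a..x, (q + ∫ t in a..y, u.d2 t)

/-- The value at `a` of the continuous representative of `u'`. -/
def H2.initSlope {a b : ℝ} (u : H2 a b) : E3 := Classical.epsilon fun q =>
  (u.d1 =ᵐ[volume.restrict (Ioo a b)] fun x => q + ∫ t in a..x, u.d2 t) ∧
    u.fn =ᵐ[volume.restrict (Ioo a b)] fun x => u.initVal + ∫ y in a..x, (q + ∫ t in a..y, u.d2 t)

/-- The continuous representative of `u'`. -/
def H2.slope {a b : ℝ} (u : H2 a b) (x : ℝ) : E3 := u.initSlope + ∫ t in a..x, u.d2 t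

/-- The continuously differentiable representative of `u`. -/
def H2.val {a b : ℝ} (u : H2 a b) (x : ℝ) : E3 := u.initVal + ∫ y in a..x, u.slope y

section Representatives

variable {a b : ℝ}

theorem H2.ae_eq_slope_and_val (hab : a < b) (u : H2 a b) :
    u.d1 =ᵐ[volume.restrict (Ioo a b)] u.slope ∧ u.fn =ᵐ[volume.restrict (Ioo a b)] u.val := by
  have h1 : ∃ q : E3, (u.d1 =ᵐ[volume.restrict (Ioo a b)] fun x => q + ∫ t in a..x, u.d2 t) ∧
      u.fn =ᵐ[volume.restrict (Ioo a b)]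
        fun x => u.initVal + ∫ y in a..x, (q + ∫ t in a..y, u.d2 t) :=
    Classical.epsilon_spec (u.exists_init hab)
  exact Classical.epsilon_spec h1

theorem H2.d1_ae_eq (hab : a < b) (u : H2 a b) : u.d1 =ᵐ[volume.restrict (Ioo a b)] u.slope :=
  (u.ae_eq_slope_and_val hab).1

theorem H2.fn_ae_eq (hab : a < b) (u : H2 a b) : u.fn =ᵐ[volume.restrict (Ioo a b)] u.val :=
  (u.ae_eq_slope_and_val hab).2

theorem H2.slope_sub (u : H2 a b) {x y : ℝ} (hx : x ∈ Icc a b) (hy : y ∈ Icc a b) :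
    u.slope y - u.slope x = ∫ t in x..y, u.d2 t := by
  have ha : a ∈ Icc a b := ⟨le_rfl, hx.1.trans hx.2⟩
  rw [H2.slope, H2.slope, add_sub_add_left_eq_sub, intervalIntegral.integral_interval_sub_left
    (L2.intervalIntegrable _ ha hy) (L2.intervalIntegrable _ ha hx)]

theorem H2.continuousOn_slope (hab : a < b) (u : H2 a b) : ContinuousOn u.slope (Icc a b) :=
  continuousOn_const.add (L2.continuousOn_primitive _ hab.le)

theorem H2.intervalIntegrable_slope (hab : a < b) (u : H2 a b) {x y : ℝ} (hx : x ∈ Icc a b)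
    (hy : y ∈ Icc a b) : IntervalIntegrable u.slope volume x y :=
  ((u.continuousOn_slope hab).mono (uIcc_subset_Icc hx hy)).intervalIntegrable

theorem H2.val_sub (hab : a < b) (u : H2 a b) {x y : ℝ} (hx : x ∈ Icc a b) (hy : y ∈ Icc a b) :
    u.val y - u.val x = ∫ t in x..y, u.slope t := by
  have ha : a ∈ Icc a b := ⟨le_rfl, hx.1.trans hx.2⟩
  rw [H2.val, H2.val, add_sub_add_left_eq_sub, intervalIntegral.integral_interval_sub_left
    (u.intervalIntegrable_slope hab ha hy) (u.intervalIntegrable_slope hab ha hx)]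

theorem hasDerivWithinAt_primitive {E : Type*} [NormedAddCommGroup E] [NormedSpace ℝ E]
    [CompleteSpace E] {f : ℝ → E} (hf : ContinuousOn f (Icc a b)) (c : E) {x : ℝ}
    (hx : x ∈ Icc a b) :
    HasDerivWithinAt (fun y => c + ∫ t in a..y, f t) (f x) (Icc a b) x := by
  have hab := hx.1.trans hx.2
  -- This instance selects the filter relative to [a, b] in the fundamental theorem of calculus, so
  -- the end points are covered as well.
  have : Fact (x ∈ Icc a b) := ⟨hx⟩
  have h := intervalIntegral.integral_hasDerivWithinAt_right (a := a) (b := x) (s := Icc a b)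
    (t := Icc a b) ((hf.mono (uIcc_subset_Icc ⟨le_rfl, hab⟩ hx)).intervalIntegrable)
    (hf.stronglyMeasurableAtFilter_nhdsWithin measurableSet_Icc x) (hf x hx)
  exact h.const_add c

theorem H2.hasDerivWithinAt_val (hab : a < b) (u : H2 a b) {x : ℝ} (hx : x ∈ Icc a b) :
    HasDerivWithinAt u.val (u.slope x) (Icc a b) x :=
  hasDerivWithinAt_primitive (u.continuousOn_slope hab) _ hx

theorem H2.continuousOn_val (hab : a < b) (u : H2 a b) : ContinuousOn u.val (Icc a b) :=
  fun _ hx => (u.hasDerivWithinAt_val hab hx).continuousWithinAt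

theorem contDiffOn_one_of_hasDerivWithinAt {E : Type*} [NormedAddCommGroup E] [NormedSpace ℝ E]
    {f g : ℝ → E} (hab : a < b) (hg : ContinuousOn g (Icc a b))
    (h : ∀ x ∈ Icc a b, HasDerivWithinAt f (g x) (Icc a b) x) : ContDiffOn ℝ 1 f (Icc a b) := by
  have hu := uniqueDiffOn_Icc hab
  rw [show (1 : WithTop ℕ∞) = 0 + 1 from rfl, contDiffOn_succ_iff_derivWithin hu]
  refine ⟨fun x hx => (h x hx).differentiableWithinAt, by simp, contDiffOn_zero.2 ?_⟩
  exact hg.congr fun x hx => (h x hx).derivWithin (hu x hx)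

theorem H2.isC1Rep_val (hab : a < b) (u : H2 a b) : u.IsC1Rep u.val :=
  ⟨contDiffOn_one_of_hasDerivWithinAt hab (u.continuousOn_slope hab) fun _ hx =>
    u.hasDerivWithinAt_val hab hx, u.fn_ae_eq hab⟩

theorem eqOn_Icc_of_ae_eq_Ioo {E : Type*} [NormedAddCommGroup E] (hab : a < b) {f g : ℝ → E}
    (h : f =ᵐ[volume.restrict (Ioo a b)] g) (hf : ContinuousOn f (Icc a b))
    (hg : ContinuousOn g (Icc a b)) : EqOn f g (Icc a b) :=
  Measure.eqOn_Icc_of_ae_eq volume hab.ne (by rwa [← restrict_Ioo_eq_restrict_Icc]) hf hg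

theorem H2.IsC1Rep.eqOn_val (hab : a < b) {u : H2 a b} {f : ℝ → E3} (hf : u.IsC1Rep f) :
    EqOn f u.val (Icc a b) :=
  eqOn_Icc_of_ae_eq_Ioo hab (hf.2.symm.trans (u.fn_ae_eq hab)) hf.1.continuousOn
    (u.continuousOn_val hab)

theorem H2.IsC1Rep.derivWithin_eq (hab : a < b) {u : H2 a b} {f : ℝ → E3} (hf : u.IsC1Rep f)
    {x : ℝ} (hx : x ∈ Icc a b) : derivWithin f (Icc a b) x = u.slope x := by
  rw [derivWithin_congr (hf.eqOn_val hab) (hf.eqOn_val hab hx)]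
  exact (u.hasDerivWithinAt_val hab hx).derivWithin (uniqueDiffOn_Icc hab x hx)

theorem H2.isC1Rep_c1Rep (hab : a < b) (u : H2 a b) : u.IsC1Rep u.c1Rep := by
  have h : ∃ f, u.IsC1Rep f := ⟨_, u.isC1Rep_val hab⟩
  rw [H2.c1Rep, dif_pos h]
  exact h.choose_spec

theorem H2.c1Rep_eq (hab : a < b) (u : H2 a b) {x : ℝ} (hx : x ∈ Icc a b) :
    u.c1Rep x = u.val x :=
  (u.isC1Rep_c1Rep hab).eqOn_val hab hx

theorem H2.c1Deriv_eq (hab : a < b) (u : H2 a b) {x : ℝ} (hx : x ∈ Icc a b) :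
    u.c1Deriv x = u.slope x :=
  (u.isC1Rep_c1Rep hab).derivWithin_eq hab hx

/-! ### Linearity and boundedness of point evaluations -/

theorem H2.val_eqOn_of_ae (hab : a < b) {u : H2 a b} {f : ℝ → E3}
    (h : u.fn =ᵐ[volume.restrict (Ioo a b)] f) (hf : ContinuousOn f (Icc a b)) :
    EqOn u.val f (Icc a b) :=
  eqOn_Icc_of_ae_eq_Ioo hab ((u.fn_ae_eq hab).symm.trans h) (u.continuousOn_val hab) hf

theorem H2.slope_eqOn_of_ae (hab : a < b) {u : H2 a b} {f : ℝ → E3}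
    (h : u.d1 =ᵐ[volume.restrict (Ioo a b)] f) (hf : ContinuousOn f (Icc a b)) :
    EqOn u.slope f (Icc a b) :=
  eqOn_Icc_of_ae_eq_Ioo hab ((u.d1_ae_eq hab).symm.trans h) (u.continuousOn_slope hab) hf

theorem H2.val_add (hab : a < b) (u v : H2 a b) {x : ℝ} (hx : x ∈ Icc a b) :
    (u + v).val x = u.val x + v.val x := by
  refine H2.val_eqOn_of_ae (f := u.val + v.val) hab ?_
    ((u.continuousOn_val hab).add (v.continuousOn_val hab)) hx
  exact (Lp.coeFn_add u.fn v.fn).trans ((u.fn_ae_eq hab).add (v.fn_ae_eq hab))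

theorem H2.slope_add (hab : a < b) (u v : H2 a b) {x : ℝ} (hx : x ∈ Icc a b) :
    (u + v).slope x = u.slope x + v.slope x := by
  refine H2.slope_eqOn_of_ae (f := u.slope + v.slope) hab ?_
    ((u.continuousOn_slope hab).add (v.continuousOn_slope hab)) hx
  exact (Lp.coeFn_add u.d1 v.d1).trans ((u.d1_ae_eq hab).add (v.d1_ae_eq hab))

theorem H2.val_smul (hab : a < b) (c : ℝ) (u : H2 a b) {x : ℝ} (hx : x ∈ Icc a b) :
    (c • u).val x = c • u.val x := by
  refine H2.val_eqOn_of_ae (f := c • u.val) hab ?_ ((u.continuousOn_val hab).const_smul c) hx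
  exact (Lp.coeFn_smul c u.fn).trans ((u.fn_ae_eq hab).const_smul c)

theorem H2.slope_smul (hab : a < b) (c : ℝ) (u : H2 a b) {x : ℝ} (hx : x ∈ Icc a b) :
    (c • u).slope x = c • u.slope x := by
  refine H2.slope_eqOn_of_ae (f := c • u.slope) hab ?_ ((u.continuousOn_slope hab).const_smul c) hx
  exact (Lp.coeFn_smul c u.d1).trans ((u.d1_ae_eq hab).const_smul c)

theorem H2.norm_slope_sub_le (u : H2 a b) {x y : ℝ} (hx : x ∈ Icc a b) (hy : y ∈ Icc a b) :
    ‖u.slope y - u.slope x‖ ≤ Real.sqrt |y - x| * ‖u.d2‖ := by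
  rw [u.slope_sub hx hy]
  exact L2.norm_intervalIntegral_le _ hx hy

theorem H2.norm_val_sub_le (hab : a < b) (u : H2 a b) {M : ℝ}
    (hM : ∀ x ∈ Icc a b, ‖u.slope x‖ ≤ M) {x y : ℝ} (hx : x ∈ Icc a b) (hy : y ∈ Icc a b) :
    ‖u.val y - u.val x‖ ≤ M * |y - x| := by
  rw [u.val_sub hab hx hy]
  exact intervalIntegral.norm_integral_le_of_norm_le_const fun t ht =>
    hM t (uIcc_subset_Icc hx hy (uIoc_subset_uIcc ht))

/-- F(x) is the mean of F minus the mean of F − F(x). Cauchy–Schwarz bounds the first by the L² norm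
and `K` bounds the second. Applied to `u'` and then to `u`, this gives the Sobolev embedding. -/
theorem H2.norm_le_of_oscillation (hab : a < b) {f : L2 a b} {F : ℝ → E3}
    (hf : f =ᵐ[volume.restrict (Ioo a b)] F) {K x : ℝ}
    (hK : ∀ y ∈ Icc a b, ‖F y - F x‖ ≤ K) :
    ‖F x‖ ≤ (Real.sqrt (b - a))⁻¹ * ‖f‖ + K := by
  have hpos : 0 < b - a := sub_pos.2 hab
  have hs : 0 < Real.sqrt (b - a) := Real.sqrt_pos.2 hpos
  have hvol : volume.real (Ioo a b) = b - a := Real.volume_real_Ioo_of_le hab.le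
  have hFi : IntegrableOn F (Ioo a b) := (L2.integrableOn f).congr hf
  have h1 : (b - a) • F x = (∫ y in Ioo a b, f y) - ∫ y in Ioo a b, (F y - F x) := by
    rw [integral_congr_ae hf, integral_sub hFi (integrable_const _), setIntegral_const, hvol,
      sub_sub_cancel]
  have h2 : ‖∫ y in Ioo a b, f y‖ ≤ Real.sqrt (b - a) * ‖f‖ := by
    rw [← hvol]
    exact (norm_integral_le_integral_norm _).trans (f.setIntegral_norm_le subset_rfl)
  have h3 : ‖∫ y in Ioo a b, (F y - F x)‖ ≤ K * (b - a) := by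
    rw [← hvol]
    exact norm_setIntegral_le_of_norm_le_const measure_Ioo_lt_top fun y hy =>
      hK y (Ioo_subset_Icc_self hy)
  have h4 : (b - a) * ‖F x‖ ≤ Real.sqrt (b - a) * ‖f‖ + K * (b - a) := by
    have := (norm_sub_le (∫ y in Ioo a b, f y) (∫ y in Ioo a b, (F y - F x))).trans (add_le_add h2 h3)
    rwa [← h1, norm_smul, Real.norm_of_nonneg hpos.le] at this
  have h5 : Real.sqrt (b - a) * Real.sqrt (b - a) = b - a := Real.mul_self_sqrt hpos.le
  refine le_of_mul_le_mul_left (h4.trans_eq ?_) hpos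
  rw [mul_add, mul_comm (b - a) K, ← mul_assoc]
  congr 2
  rw [eq_mul_inv_iff_mul_eq₀ hs.ne', h5]

theorem H2.norm_component_le (u : H2 a b) (i : Fin 3) : ‖u.1 i‖ ≤ ‖u‖ :=
  PiLp.norm_apply_le u.1 i

theorem H2.norm_slope_le (hab : a < b) (u : H2 a b) {x : ℝ} (hx : x ∈ Icc a b) :
    ‖u.slope x‖ ≤ ((Real.sqrt (b - a))⁻¹ + Real.sqrt (b - a)) * ‖u‖ := by
  have h := H2.norm_le_of_oscillation (x := x) hab (u.d1_ae_eq hab)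
    (K := Real.sqrt (b - a) * ‖u.d2‖) fun y hy => (u.norm_slope_sub_le hx hy).trans
      (mul_le_mul_of_nonneg_right (Real.sqrt_le_sqrt
        (abs_le.2 ⟨by linarith [hx.2, hy.1], by linarith [hx.1, hy.2]⟩)) (norm_nonneg _))
  have h1 : ‖u.d1‖ ≤ ‖u‖ := u.norm_component_le 1
  have h2 : ‖u.d2‖ ≤ ‖u‖ := u.norm_component_le 2
  refine h.trans ?_
  rw [add_mul]
  gcongr

theorem H2.norm_val_le (hab : a < b) (u : H2 a b) {x : ℝ} (hx : x ∈ Icc a b) :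
    ‖u.val x‖ ≤ ((Real.sqrt (b - a))⁻¹
      + ((Real.sqrt (b - a))⁻¹ + Real.sqrt (b - a)) * (b - a)) * ‖u‖ := by
  have hpos : 0 < b - a := sub_pos.2 hab
  have h := H2.norm_le_of_oscillation (x := x) hab (u.fn_ae_eq hab)
    (K := ((Real.sqrt (b - a))⁻¹ + Real.sqrt (b - a)) * ‖u‖ * (b - a)) fun y hy =>
      (u.norm_val_sub_le hab (fun z hz => u.norm_slope_le hab hz) hx hy).trans
      (mul_le_mul_of_nonneg_left (abs_le.2 ⟨by linarith [hx.2, hy.1], by linarith [hx.1, hy.2]⟩)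
        (by positivity))
  have h1 : ‖u.fn‖ ≤ ‖u‖ := u.norm_component_le 0
  have h2 := mul_le_mul_of_nonneg_left h1 (inv_nonneg.2 (Real.sqrt_nonneg (b - a)))
  linarith

/-- Evaluation of `u` at a point of `[a, b]`. -/
def H2.valL (hab : a < b) {x : ℝ} (hx : x ∈ Icc a b) : H2 a b →L[ℝ] E3 :=
  LinearMap.mkContinuous
    { toFun := fun u => u.val x
      map_add' := fun u v => H2.val_add hab u v hx
      map_smul' := fun c u => H2.val_smul hab c u hx } _ fun u => u.norm_val_le hab hx

/-- Evaluation of `u'` at a point of `[a, b]`. -/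
def H2.slopeL (hab : a < b) {x : ℝ} (hx : x ∈ Icc a b) : H2 a b →L[ℝ] E3 :=
  LinearMap.mkContinuous
    { toFun := fun u => u.slope x
      map_add' := fun u v => H2.slope_add hab u v hx
      map_smul' := fun c u => H2.slope_smul hab c u hx } _ fun u => u.norm_slope_le hab hx

end Representatives

/-! ### Construction of `H²` functions from initial data and a second derivative -/

theorem memLp_of_continuousOn {E : Type*} [NormedAddCommGroup E] {a b : ℝ} {f : ℝ → E}
    (hf : ContinuousOn f (Icc a b)) : MemLp f 2 (volume.restrict (Ioo a b)) := by
  obtain ⟨C, hC⟩ := isCompact_Icc.exists_bound_of_continuousOn hf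
  refine MemLp.of_bound ((hf.mono Ioo_subset_Icc_self).aestronglyMeasurable measurableSet_Ioo) C ?_
  filter_upwards [ae_restrict_mem measurableSet_Ioo] with x hx
  exact hC x (Ioo_subset_Icc_self hx)

theorem exists_isWeakDeriv_primitive {a b : ℝ} (hab : a < b) (c : E3) (g : L2 a b) :
    ∃ f : L2 a b, IsWeakDeriv f g ∧
      f =ᵐ[volume.restrict (Ioo a b)] fun x => c + ∫ t in a..x, g t := by
  have hcont : ContinuousOn (fun x => c + ∫ t in a..x, g t) (Icc a b) :=
    continuousOn_const.add (L2.continuousOn_primitive g hab.le)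
  have hmem := memLp_of_continuousOn hcont
  refine ⟨hmem.toLp _, ?_, hmem.coeFn_toLp⟩
  intro φ hφ hc hs
  rw [← integral_deriv_smul_primitive hab (L2.integrableOn g) c hφ hc hs]
  refine integral_congr_ae ?_
  filter_upwards [hmem.coeFn_toLp] with x hx
  rw [hx]

theorem H2.exists_of_init {a b : ℝ} (hab : a < b) (p q : E3) (g : L2 a b) :
    ∃ u : H2 a b, u.d2 = g ∧ u.val a = p ∧ u.slope a = q := by
  obtain ⟨f₁, h₁, e₁⟩ := exists_isWeakDeriv_primitive hab q g
  obtain ⟨f₀, h₀, e₀⟩ := exists_isWeakDeriv_primitive hab p f₁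
  have hmem : (WithLp.toLp 2 ![f₀, f₁, g] : PiLp 2 (fun _ : Fin 3 => L2 a b)) ∈ Sobolev 2 a b := by
    intro i
    fin_cases i
    · exact h₀
    · exact h₁
  refine ⟨⟨_, hmem⟩, rfl, ?_, ?_⟩
  · have := H2.val_eqOn_of_ae (u := ⟨_, hmem⟩) hab e₀
      (continuousOn_const.add (L2.continuousOn_primitive f₁ hab.le)) (left_mem_Icc.2 hab.le)
    simpa using this
  · have := H2.slope_eqOn_of_ae (u := ⟨_, hmem⟩) hab e₁
      (continuousOn_const.add (L2.continuousOn_primitive g hab.le)) (left_mem_Icc.2 hab.le)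
    simpa using this

/-! ### Completeness and weak compactness -/

/-- The pairing of `L²` functions with a test function. -/
def testPairing {a b : ℝ} {ψ : ℝ → ℝ} (hψ : Continuous ψ) (hc : HasCompactSupport ψ) :
    L2 a b →L[ℝ] E3 :=
  LinearMap.mkContinuousOfExistsBound
    { toFun := fun f => ∫ x in Ioo a b, ψ x • f x
      map_add' := fun f g => by
        rw [← integral_add (integrable_test_smul f hψ hc) (integrable_test_smul g hψ hc)]
        refine integral_congr_ae ?_
        filter_upwards [Lp.coeFn_add f g] with x hx
        rw [hx, Pi.add_apply, smul_add]
      map_smul' := fun c f => by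
        rw [RingHom.id_apply, ← integral_smul]
        refine integral_congr_ae ?_
        filter_upwards [Lp.coeFn_smul c f] with x hx
        rw [hx, Pi.smul_apply, smul_comm] } (by
    obtain ⟨C, hC⟩ := hc.exists_bound_of_continuous hψ
    have hC0 : 0 ≤ C := (norm_nonneg _).trans (hC 0)
    refine ⟨C * Real.sqrt (volume.real (Ioo a b)), fun f => ?_⟩
    refine (norm_integral_le_integral_norm _).trans ?_
    calc ∫ x in Ioo a b, ‖ψ x • f x‖ ≤ ∫ x in Ioo a b, C * ‖f x‖ := by
          refine integral_mono (integrable_test_smul f hψ hc).norm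
            ((L2.integrableOn f).norm.const_mul C) fun x => ?_
          simp only [norm_smul]
          exact mul_le_mul_of_nonneg_right (hC x) (norm_nonneg _)
      _ = C * ∫ x in Ioo a b, ‖f x‖ := integral_const_mul _ _
      _ ≤ _ := by
          rw [mul_assoc]
          exact mul_le_mul_of_nonneg_left (f.setIntegral_norm_le subset_rfl) hC0)

/-- For each test function the defining identity equates two continuous maps. Completeness of H²
follows, as needed for the Riesz representation. -/
theorem isClosed_sobolev (k : ℕ) (a b : ℝ) :
    IsClosed (Sobolev k a b : Set (PiLp 2 (fun _ : Fin (k + 1) => L2 a b))) := by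
  have : (Sobolev k a b : Set (PiLp 2 (fun _ : Fin (k + 1) => L2 a b)))
      = ⋂ (i : Fin k) (φ : ℝ → ℝ) (hφ : ContDiff ℝ ∞ φ) (hc : HasCompactSupport φ)
        (_ : tsupport φ ⊆ Ioo a b), {u | testPairing (hφ.continuous_deriv (by simp)) hc.deriv
          (u i.castSucc) = - testPairing hφ.continuous hc (u i.succ)} := by
    ext u
    simp only [mem_iInter, mem_ofPred_eq]
    exact Iff.rfl
  rw [this]
  refine isClosed_iInter fun i => isClosed_iInter fun φ => isClosed_iInter fun hφ =>
    isClosed_iInter fun hc => isClosed_iInter fun hs => ?_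
  refine isClosed_eq ?_ ?_
  · exact (testPairing _ _).continuous.comp (PiLp.continuous_apply 2 _ _)
  · exact continuous_neg.comp ((testPairing _ _).continuous.comp (PiLp.continuous_apply 2 _ _))

instance H2.completeSpace (a b : ℝ) : CompleteSpace (H2 a b) :=
  (isClosed_sobolev 2 a b).completeSpace_coe

/-- Bounded sequences in a separable Hilbert space have weakly convergent subsequences. -/
theorem exists_weak_subseq_limit {H : Type*} [NormedAddCommGroup H] [InnerProductSpace ℝ H]
    [CompleteSpace H] [TopologicalSpace.SeparableSpace H] {v : ℕ → H} {C : ℝ}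
    (hv : ∀ n, ‖v n‖ ≤ C) :
    ∃ ψ : ℕ → ℕ, StrictMono ψ ∧ ∃ v₀ : H, ∀ F : H →L[ℝ] ℝ,
      Tendsto (fun n => F (v (ψ n))) atTop (𝓝 (F v₀)) := by
  -- The Riesz isomorphism places the sequence in a closed ball of the dual, which is weak-*
  -- sequentially compact because `H` is separable.
  have hmem : ∀ n, StrongDual.toWeakDual (InnerProductSpace.toDual ℝ H (v n)) ∈
      WeakDual.toStrongDual ⁻¹' Metric.closedBall (0 : StrongDual ℝ H) C := by
    intro n
    rw [mem_preimage, mem_closedBall_zero_iff]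
    simpa using hv n
  obtain ⟨f, -, ψ, hψ, hlim⟩ := WeakDual.isSeqCompact_closedBall ℝ H 0 C hmem
  refine ⟨ψ, hψ, (InnerProductSpace.toDual ℝ H).symm (WeakDual.toStrongDual f), fun F => ?_⟩
  have h := (WeakDual.eval_continuous ((InnerProductSpace.toDual ℝ H).symm F)).tendsto f |>.comp hlim
  have e : ∀ w : H, F w = inner ℝ w ((InnerProductSpace.toDual ℝ H).symm F) := fun w => by
    rw [real_inner_comm, InnerProductSpace.toDual_symm_apply]
  simp only [e]
  rw [InnerProductSpace.toDual_symm_apply]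
  exact h

instance H2.separableSpace (a b : ℝ) : TopologicalSpace.SeparableSpace (H2 a b) := by
  have : Fact ((2 : ENNReal) ≠ ⊤) := ⟨by norm_num⟩
  infer_instance

/-! ### Projection onto piecewise affine functions -/

theorem memLp_indicator_pow_smul (a b s t : ℝ) (k : ℕ) (e : E3) :
    MemLp ((Ioo s t).indicator fun x => x ^ k • e) 2 (volume.restrict (Ioo a b)) :=
  (memLp_of_continuousOn (by fun_prop)).indicator measurableSet_Ioo

/-- The function `x ↦ x ^ k • e` restricted to `(s, t)`, as an element of `L²(a, b)`. -/
def monomialOn (a b s t : ℝ) (k : ℕ) (e : E3) : L2 a b :=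
  (memLp_indicator_pow_smul a b s t k e).toLp _

theorem monomialOn_ae_eq (a b s t : ℝ) (k : ℕ) (e : E3) :
    monomialOn a b s t k e =ᵐ[volume.restrict (Ioo a b)] (Ioo s t).indicator fun x => x ^ k • e :=
  MemLp.coeFn_toLp _

/-- Through this identity, orthogonality to piecewise affine functions becomes vanishing of the
moments of order 0 and 1 on each element. -/
theorem inner_monomialOn {a b s t : ℝ} (ha : a ≤ s) (hst : s ≤ t) (hb : t ≤ b) (k : ℕ) (e : E3)
    (g : L2 a b) : inner ℝ (monomialOn a b s t k e) g = inner ℝ e (∫ x in s..t, x ^ k • g x) := by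
  have hsub : Ioo s t ⊆ Ioo a b := Ioo_subset_Ioo ha hb
  have hi : IntegrableOn (fun x => x ^ k • g x) (Ioo s t) := by
    obtain ⟨C, hC⟩ := isCompact_Icc.exists_bound_of_continuousOn
      (f := fun x : ℝ => x ^ k) (s := Icc s t) (by fun_prop)
    refine Integrable.bdd_smul ((L2.integrableOn g).mono_set hsub) C
      (by fun_prop : Continuous fun x : ℝ => x ^ k).aestronglyMeasurable ?_
    filter_upwards [ae_restrict_mem measurableSet_Ioo] with x hx using hC x (Ioo_subset_Icc_self hx)
  rw [L2.inner_def, intervalIntegral.integral_of_le hst, integral_Ioc_eq_integral_Ioo,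
    ← integral_inner hi]
  have h1 : ∀ᵐ x ∂(volume.restrict (Ioo a b)), inner ℝ (monomialOn a b s t k e x) (g x)
      = (Ioo s t).indicator (fun x => inner ℝ e (x ^ k • g x)) x := by
    filter_upwards [monomialOn_ae_eq a b s t k e] with x hx
    rw [hx]
    by_cases h : x ∈ Ioo s t
    · rw [indicator_of_mem h, indicator_of_mem h, real_inner_smul_left, real_inner_smul_right]
    · rw [indicator_of_notMem h, indicator_of_notMem h, inner_zero_left]
  rw [integral_congr_ae h1, setIntegral_indicator measurableSet_Ioo, inter_eq_right.2 hsub]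

namespace Partition

variable {a b : ℝ} (P : Partition a b)

theorem node_mem (i : Fin (P.N + 1)) : P.node i ∈ Icc a b :=
  ⟨P.node_zero.symm.trans_le (P.strictMono.monotone (Fin.zero_le i)),
    (P.strictMono.monotone (Fin.le_last i)).trans_eq P.node_last⟩

theorem node_lt (i : Fin P.N) : P.node i.castSucc < P.node i.succ :=
  P.strictMono Fin.castSucc_lt_succ

theorem disjoint_Ioo {i j : Fin P.N} (h : i ≠ j) :
    Disjoint (Ioo (P.node i.castSucc) (P.node i.succ)) (Ioo (P.node j.castSucc) (P.node j.succ)) := by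
  wlog hij : i < j generalizing i j
  · exact (this h.symm (lt_of_le_of_ne (le_of_not_gt hij) h.symm)).symm
  have hle : P.node i.succ ≤ P.node j.castSucc := P.strictMono.monotone (by
    simp only [Fin.le_def, Fin.val_succ, Fin.val_castSucc]; exact hij)
  rw [Set.disjoint_left]
  intro x hx hx'
  linarith [hx.2, hx'.1]

/-- The discontinuous piecewise affine functions on a partition, as a subspace of `L²`. -/
def piecewiseAffine : Submodule ℝ (L2 a b) :=
  Submodule.span ℝ (range fun p : Fin P.N × Fin 2 × Fin 3 =>
    monomialOn a b (P.node p.1.castSucc) (P.node p.1.succ) p.2.1 (EuclideanSpace.single p.2.2 1))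

instance : FiniteDimensional ℝ P.piecewiseAffine :=
  FiniteDimensional.span_of_finite ℝ (finite_range _)

theorem ae_affine_of_mem_piecewiseAffine {g : L2 a b} (hg : g ∈ P.piecewiseAffine) (i : Fin P.N) :
    ∃ c₀ c₁ : E3, ∀ᵐ x ∂(volume.restrict (Ioo a b)),
      x ∈ Ioo (P.node i.castSucc) (P.node i.succ) → g x = c₀ + x • c₁ := by
  induction hg using Submodule.span_induction with
  | mem g hg =>
    obtain ⟨⟨j, k, m⟩, rfl⟩ := hg
    have h := monomialOn_ae_eq a b (P.node j.castSucc) (P.node j.succ) k (EuclideanSpace.single m 1)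
    by_cases hij : i = j
    · subst hij
      fin_cases k
      · refine ⟨EuclideanSpace.single m 1, 0, ?_⟩
        filter_upwards [h] with x hx hxi
        refine hx.trans ?_
        rw [indicator_of_mem hxi]
        simp
      · refine ⟨0, EuclideanSpace.single m 1, ?_⟩
        filter_upwards [h] with x hx hxi
        refine hx.trans ?_
        rw [indicator_of_mem hxi]
        simp
    · refine ⟨0, 0, ?_⟩
      filter_upwards [h] with x hx hxi
      refine hx.trans ?_
      rw [indicator_of_notMem (Set.disjoint_left.1 (P.disjoint_Ioo hij) hxi)]
      simp
  | zero =>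
    refine ⟨0, 0, ?_⟩
    filter_upwards [Lp.coeFn_zero E3 2 (volume.restrict (Ioo a b))] with x hx _
    rw [hx]; simp
  | add f g _ _ hf hg =>
    obtain ⟨c₀, c₁, hf⟩ := hf
    obtain ⟨d₀, d₁, hg⟩ := hg
    refine ⟨c₀ + d₀, c₁ + d₁, ?_⟩
    filter_upwards [hf, hg, Lp.coeFn_add f g] with x h1 h2 h3 hxi
    rw [h3, Pi.add_apply, h1 hxi, h2 hxi, smul_add]
    abel
  | smul r f _ hf =>
    obtain ⟨c₀, c₁, hf⟩ := hf
    refine ⟨r • c₀, r • c₁, ?_⟩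
    filter_upwards [hf, Lp.coeFn_smul r f] with x h1 h2 hxi
    rw [h2, Pi.smul_apply, h1 hxi, smul_add, smul_comm]

/-- Take the orthogonal projection: it is a contraction, and its residual is orthogonal to every
generator. -/
theorem exists_piecewiseAffine (g : L2 a b) :
    ∃ p ∈ P.piecewiseAffine, ‖p‖ ≤ ‖g‖ ∧ ∀ (i : Fin P.N) (k : Fin 2),
      ∫ x in P.node i.castSucc..P.node i.succ, x ^ (k : ℕ) • (p - g) x = 0 := by
  refine ⟨P.piecewiseAffine.starProjection g, Submodule.starProjection_apply_mem _ _,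
    Submodule.norm_starProjection_apply_le _ _, fun i k => ?_⟩
  refine PiLp.ext fun m => ?_
  have h1 : g - P.piecewiseAffine.starProjection g ∈ P.piecewiseAffineᗮ :=
    Submodule.sub_starProjection_mem_orthogonal g
  have h2 := (Submodule.mem_orthogonal _ _).1 (neg_mem h1) _
    (Submodule.subset_span ⟨(i, k, m), rfl⟩)
  rw [neg_sub, inner_monomialOn (P.node_mem _).1 (P.node_lt i).le (P.node_mem _).2] at h2
  rw [EuclideanSpace.inner_single_left] at h2
  simpa using h2

end Partition

/-! ### Hermite interpolation by cubic splines -/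

theorem integral_primitive {E : Type*} [NormedAddCommGroup E] [NormedSpace ℝ E]
    [CompleteSpace E] {s t : ℝ} (hst : s ≤ t) {g : ℝ → E} (hg : IntegrableOn g (Ioo s t)) :
    ∫ x in s..t, (∫ y in s..x, g y) = ∫ y in s..t, (t - y) • g y := by
  have h := integral_smul_primitive (ψ := fun _ => 1) (integrableOn_const (by simp)) hg
  simp only [one_smul, intervalIntegral.integral_const, smul_eq_mul, mul_one] at h
  rw [intervalIntegral.integral_of_le hst, intervalIntegral.integral_of_le hst,
    integral_Ioc_eq_integral_Ioo, integral_Ioc_eq_integral_Ioo, h]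

theorem hasDerivAt_cubic {E : Type*} [NormedAddCommGroup E] [NormedSpace ℝ E] (A c₀ c₁ : E)
    (y : ℝ) : HasDerivAt (fun x : ℝ => x • A + (x ^ 2 / 2) • c₀ + (x ^ 3 / 6) • c₁)
      (A + y • c₀ + (y ^ 2 / 2) • c₁) y := by
  have h2 : HasDerivAt (fun x : ℝ => x ^ 2 / 2) y y :=
    ((hasDerivAt_pow 2 y).div_const 2).congr_deriv (by norm_num)
  have h3 : HasDerivAt (fun x : ℝ => x ^ 3 / 6) (y ^ 2 / 2) y :=
    ((hasDerivAt_pow 3 y).div_const 6).congr_deriv (by norm_num; ring)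
  exact ((((hasDerivAt_id' y).smul_const A).congr_deriv (one_smul ℝ A)).fun_add
    (h2.smul_const c₀)).fun_add (h3.smul_const c₁)

section Splines

variable {a b : ℝ}

theorem H2.exists_cubic_of_affine (hab : a < b) (u : H2 a b) {s t : ℝ} (hs : s ∈ Icc a b)
    (ht : t ∈ Icc a b) {c₀ c₁ : E3}
    (h : ∀ᵐ x ∂(volume.restrict (Ioo a b)), x ∈ Ioo s t → u.d2 x = c₀ + x • c₁) :
    ∃ c : Fin 4 → E3, ∀ x ∈ Icc s t, u.val x = ∑ j : Fin 4, x ^ (j : ℕ) • c j := by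
  have hI : Icc s t ⊆ Icc a b := Icc_subset_Icc hs.1 ht.2
  have h' := (ae_restrict_iff' measurableSet_Ioo).1 h
  -- `A` is the constant of integration that makes the quadratic formula for the slope exact at `s`.
  set A : E3 := u.slope s - s • c₀ - (s ^ 2 / 2) • c₁ with hA
  have hslope : ∀ x ∈ Icc s t, u.slope x = A + x • c₀ + (x ^ 2 / 2) • c₁ := by
    intro x hx
    have hd : ∀ y ∈ uIcc s x, HasDerivAt (fun y : ℝ => y • c₀ + (y ^ 2 / 2) • c₁) (c₀ + y • c₁) y :=
      fun y _ => by simpa using hasDerivAt_cubic c₀ c₁ 0 y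
    have h3 : ∫ y in s..x, u.d2 y = ∫ y in s..x, (c₀ + y • c₁) := by
      refine intervalIntegral.integral_congr_ae ?_
      -- The affine formula holds only on the open interval, while `x` may equal `t`; the null set
      -- {t} is discarded.
      filter_upwards [h', (measure_eq_zero_iff_ae_notMem.1 (measure_singleton t) :
        ∀ᵐ y ∂volume, y ∉ ({t} : Set ℝ))] with y hy hyt hyI
      rw [uIoc_of_le hx.1] at hyI
      have hyt' : y < t := lt_of_le_of_ne (hyI.2.trans hx.2) hyt
      exact hy ⟨hs.1.trans_lt hyI.1, hyt'.trans_le ht.2⟩ ⟨hyI.1, hyt'⟩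
    have h4 := u.slope_sub hs (hI hx)
    rw [h3, intervalIntegral.integral_eq_sub_of_hasDerivAt hd
      ((by fun_prop : Continuous fun y : ℝ => c₀ + y • c₁).intervalIntegrable _ _)] at h4
    rw [sub_eq_iff_eq_add.1 h4, hA]
    abel
  set Q : ℝ → E3 := fun x => x • A + (x ^ 2 / 2) • c₀ + (x ^ 3 / 6) • c₁ with hQ
  -- `Q` is a primitive of the slope without constant term, so the constant coefficient has to
  -- correct its value at `s`.
  refine ⟨![u.val s - Q s, A, (1 / 2 : ℝ) • c₀, (1 / 6 : ℝ) • c₁], fun x hx => ?_⟩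
  have hd : ∀ y ∈ uIcc s x, HasDerivAt Q (A + y • c₀ + (y ^ 2 / 2) • c₁) y :=
    fun y _ => hasDerivAt_cubic A c₀ c₁ y
  have h3 : ∫ y in s..x, u.slope y = ∫ y in s..x, (A + y • c₀ + (y ^ 2 / 2) • c₁) := by
    refine intervalIntegral.integral_congr fun y hy => ?_
    rw [uIcc_of_le hx.1] at hy
    exact hslope y ⟨hy.1, hy.2.trans hx.2⟩
  have h4 := u.val_sub hab hs (hI hx)
  rw [h3, intervalIntegral.integral_eq_sub_of_hasDerivAt hd
    ((by fun_prop : Continuous fun y : ℝ => A + y • c₀ + (y ^ 2 / 2) • c₁).intervalIntegrable _ _)]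
    at h4
  rw [sub_eq_iff_eq_add.1 h4]
  simp only [Fin.sum_univ_four, hQ]
  simp [smul_smul]
  simp only [div_eq_mul_inv]
  abel

theorem H2.mem_splineSpace (hab : a < b) (P : Partition a b) {u : H2 a b}
    (hu : u.d2 ∈ P.piecewiseAffine) : u ∈ splineSpace P := by
  refine ⟨u.val, ⟨(u.isC1Rep_val hab).1, fun i => ?_⟩, u.fn_ae_eq hab⟩
  obtain ⟨c₀, c₁, h⟩ := P.ae_affine_of_mem_piecewiseAffine hu i
  exact u.exists_cubic_of_affine hab (P.node_mem _) (P.node_mem _) h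

theorem H2.val_sub_apply (hab : a < b) (u v : H2 a b) {x : ℝ} (hx : x ∈ Icc a b) :
    (u - v).val x = u.val x - v.val x := (H2.valL hab hx).map_sub u v

theorem H2.slope_sub_apply (hab : a < b) (u v : H2 a b) {x : ℝ} (hx : x ∈ Icc a b) :
    (u - v).slope x = u.slope x - v.slope x := (H2.slopeL hab hx).map_sub u v

/-- The cubic Hermite interpolant of `v` does not increase the `L²` norm of the second
derivative. -/
theorem H2.exists_spline_interpolant (hab : a < b) (P : Partition a b) (v : H2 a b) :
    ∃ s ∈ splineSpace P, ‖s.d2‖ ≤ ‖v.d2‖ ∧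
      ∀ i, s.val (P.node i) = v.val (P.node i) ∧ s.slope (P.node i) = v.slope (P.node i) := by
  obtain ⟨p, hp, hle, horth⟩ := P.exists_piecewiseAffine v.d2
  -- Only the data at `a` are prescribed; agreement at the later nodes comes from the vanishing
  -- moments.
  obtain ⟨s, hsd, hsv, hss⟩ := H2.exists_of_init hab (v.val a) (v.slope a) p
  refine ⟨s, H2.mem_splineSpace hab P (hsd ▸ hp), hsd ▸ hle, ?_⟩
  set w := s - v with hw
  have hwd : w.d2 = p - v.d2 := by rw [← hsd]; rfl
  suffices h : ∀ i, w.val (P.node i) = 0 ∧ w.slope (P.node i) = 0 by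
    intro i
    have := h i
    rw [hw, H2.val_sub_apply hab _ _ (P.node_mem i), H2.slope_sub_apply hab _ _ (P.node_mem i)] at this
    exact ⟨sub_eq_zero.1 this.1, sub_eq_zero.1 this.2⟩
  intro i
  induction i using Fin.induction with
  | zero =>
    have ha : a ∈ Icc a b := left_mem_Icc.2 hab.le
    rw [P.node_zero, hw, H2.val_sub_apply hab _ _ ha, H2.slope_sub_apply hab _ _ ha, hsv, hss]
    simp
  | succ i ih =>
    -- The moment of order 0 carries w' = 0 to the next node. The increment of `w` is ∫ (x_{i+1} −
    -- y) w''(y) dy, which vanishes by both moments.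
    have h0 : ∫ x in P.node i.castSucc..P.node i.succ, w.d2 x = 0 := by
      have := horth i 0
      simpa [← hwd] using this
    have h1 : ∫ x in P.node i.castSucc..P.node i.succ, x • w.d2 x = 0 := by
      have := horth i 1
      simpa [← hwd] using this
    have hmc := P.node_mem i.castSucc
    have hms := P.node_mem i.succ
    have hslope := w.slope_sub hmc hms
    rw [h0, ih.2, sub_zero] at hslope
    refine ⟨?_, hslope⟩
    have hval := w.val_sub hab hmc hms
    rw [ih.1, sub_zero] at hval
    have hii := L2.intervalIntegrable w.d2 hmc hms
    rw [hval, intervalIntegral.integral_congr (g := fun x => ∫ y in P.node i.castSucc..x, w.d2 y),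
      integral_primitive (P.node_lt i).le
        ((L2.integrableOn w.d2).mono_set (Ioo_subset_Ioo hmc.1 hms.2))]
    · simp only [sub_smul]
      refine (intervalIntegral.integral_sub (hii.smul (P.node i.succ))
        (hii.continuousOn_smul continuousOn_id)).trans ?_
      simp only [Pi.smul_apply, id_eq]
      rw [intervalIntegral.integral_smul, h0, h1, smul_zero, sub_zero]
    · intro x hx
      rw [uIcc_of_le (P.node_lt i).le] at hx
      have := w.slope_sub hmc (Icc_subset_Icc hmc.1 hms.2 hx)
      rwa [ih.2, sub_zero] at this

end Splines

theorem L2.integral_norm_sq {a b : ℝ} (g : L2 a b) : ∫ x in Ioo a b, ‖g x‖ ^ 2 = ‖g‖ ^ 2 := by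
  rw [← real_inner_self_eq_norm_sq, L2.inner_def]
  simp only [real_inner_self_eq_norm_sq]

/-! ### The confinement potential -/

section Potential

variable {R : ℕ} (G : Fin R → Matrix (Fin 3) (Fin 3) ℝ)

theorem continuous_quadraticForm (A : Matrix (Fin 3) (Fin 3) ℝ) :
    Continuous fun y : E3 => y.ofLp ⬝ᵥ (A.mulVec y.ofLp) := by
  simp only [dotProduct, Matrix.mulVec]
  fun_prop

theorem continuous_potential : Continuous (potential G) := by
  unfold potential confNorm
  have := fun r => continuous_quadraticForm (G r)
  fun_prop

theorem potential_nonneg (y : E3) : 0 ≤ potential G y :=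
  Finset.sum_nonneg fun _ _ => by positivity

theorem confNorm_le_of_potential_le {y : E3} {c : ℝ} (h : potential G y ≤ c) (r : Fin R) :
    confNorm (G r) y ≤ 1 + Real.sqrt (2 * c) := by
  have h1 : (1 / 2 : ℝ) * (max (confNorm (G r) y - 1) 0) ^ 2 ≤ c :=
    (Finset.single_le_sum (f := fun r => (1 / 2 : ℝ) * (max (confNorm (G r) y - 1) 0) ^ 2)
      (fun _ _ => by positivity) (Finset.mem_univ r)).trans h
  have h2 : max (confNorm (G r) y - 1) 0 ≤ Real.sqrt (2 * c) := Real.le_sqrt_of_sq_le (by linarith)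
  linarith [le_max_left (confNorm (G r) y - 1) 0]

theorem potential_eq_zero_iff {y : E3} : potential G y = 0 ↔ y ∈ confinement G := by
  constructor
  · intro h r
    have := confNorm_le_of_potential_le G h.le r
    -- √q ≤ 1 is equivalent to q ≤ 1 for every real q, since the square root of a negative number is
    -- 0.
    rw [mul_zero, Real.sqrt_zero, add_zero, confNorm, Real.sqrt_le_left zero_le_one, one_pow] at this
    exact this
  · intro h
    refine Finset.sum_eq_zero fun r _ => ?_
    have : confNorm (G r) y ≤ 1 := (Real.sqrt_le_left zero_le_one).2 ((h r).trans_eq (one_pow 2).symm)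
    rw [max_eq_right (by linarith)]
    simp

/-- By homogeneity, the sublevel set of the potential at `c` lies in the dilation of D by ρ = 1 +
√(2c). -/
theorem norm_le_of_potential_le {M : ℝ} (hM : ∀ y ∈ confinement G, ‖y‖ ≤ M) {y : E3} {c : ℝ}
    (h : potential G y ≤ c) : ‖y‖ ≤ (1 + Real.sqrt (2 * c)) * M := by
  set ρ := 1 + Real.sqrt (2 * c) with hρ
  have hpos : 0 < ρ := by positivity
  have hmem : ρ⁻¹ • y ∈ confinement G := by
    intro r
    have h1 : y.ofLp ⬝ᵥ ((G r).mulVec y.ofLp) ≤ ρ ^ 2 :=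
      (Real.sqrt_le_left hpos.le).1 (confNorm_le_of_potential_le G h r)
    rw [WithLp.ofLp_smul, Matrix.mulVec_smul, dotProduct_smul, smul_dotProduct, smul_eq_mul, smul_eq_mul]
    calc ρ⁻¹ * (ρ⁻¹ * (y.ofLp ⬝ᵥ ((G r).mulVec y.ofLp))) ≤ ρ⁻¹ * (ρ⁻¹ * ρ ^ 2) := by gcongr
      _ = 1 := by field_simp
  have := hM _ hmem
  rw [norm_smul, Real.norm_of_nonneg (by positivity)] at this
  rwa [inv_mul_le_iff₀ hpos] at this

end Potential

/-! ### Nodal interpolation -/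

namespace Partition

variable {a b : ℝ} (P : Partition a b)

theorem sub_le_mesh (i : Fin P.N) : P.node i.succ - P.node i.castSucc ≤ P.mesh :=
  le_ciSup (f := fun i : Fin P.N => P.node i.succ - P.node i.castSucc) (finite_range _).bddAbove i

theorem exists_mem_Icc {x : ℝ} (hx : x ∈ Ioo a b) :
    ∃ i : Fin P.N, x ∈ Icc (P.node i.castSucc) (P.node i.succ) := by
  have h : ∀ i, x ≤ P.node i → ∃ i : Fin P.N, x ∈ Icc (P.node i.castSucc) (P.node i.succ) := by
    intro i
    induction i using Fin.induction with
    | zero => intro h; rw [P.node_zero] at h; exact absurd hx.1 (not_lt.2 h)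
    | succ i ih =>
      intro h
      rcases le_total x (P.node i.castSucc) with h' | h'
      · exact ih h'
      · exact ⟨i, h', h⟩
  exact h (Fin.last _) (by rw [P.node_last]; exact hx.2.le)

/-- The two nodes and the weight depend only on `x`, not on `g`. -/
theorem exists_interp_eq {x : ℝ} (hx : x ∈ Ioo a b) :
    ∃ i j : Fin (P.N + 1), |P.node i - x| ≤ P.mesh ∧ |P.node j - x| ≤ P.mesh ∧
      ∃ θ ∈ Icc (0 : ℝ) 1, ∀ g, P.interp g x = (1 - θ) * g (P.node i) + θ * g (P.node j) := by
  obtain ⟨i, hi⟩ := P.exists_mem_Icc hx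
  have hm := P.sub_le_mesh i
  have hpos := sub_pos.2 (P.node_lt i)
  refine ⟨i.castSucc, i.succ, abs_le.2 ⟨by linarith [hi.2], by linarith [hi.1]⟩,
    abs_le.2 ⟨by linarith [hi.2], by linarith [hi.1]⟩,
    (x - P.node i.castSucc) / (P.node i.succ - P.node i.castSucc),
    ⟨div_nonneg (by linarith [hi.1]) hpos.le, (div_le_one hpos).2 (by linarith [hi.2])⟩,
    fun g => ?_⟩
  rw [P.interp_eq g i hi]
  ring

theorem continuous_interp (g : ℝ → ℝ) : Continuous (P.interp g) := by
  unfold interp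
  fun_prop

theorem le_interp {g : ℝ → ℝ} {c : ℝ} (hg : ∀ i, c ≤ g (P.node i)) {x : ℝ} (hx : x ∈ Ioo a b) :
    c ≤ P.interp g x := by
  obtain ⟨i, j, -, -, θ, hθ, h⟩ := P.exists_interp_eq hx
  rw [h]
  have h1 := mul_le_mul_of_nonneg_left (hg i) (sub_nonneg.2 hθ.2)
  have h2 := mul_le_mul_of_nonneg_left (hg j) hθ.1
  linarith

theorem integrableOn_interp (g : ℝ → ℝ) : IntegrableOn (P.interp g) (Ioo a b) :=
  (P.continuous_interp g).continuousOn.integrableOn_Icc.mono_set Ioo_subset_Icc_self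

theorem integral_interp_nonneg {g : ℝ → ℝ} (hg : ∀ x, 0 ≤ g x) :
    0 ≤ ∫ x in Ioo a b, P.interp g x :=
  setIntegral_nonneg measurableSet_Ioo fun _ hx => P.le_interp (fun _ => hg _) hx

/-- The interpolant is bounded below by the least nodal value, so if all nodal values were larger
the integral would be at least A + (b − a). The summand 1 makes this a strict contradiction. -/
theorem exists_node_le (hab : a < b) {g : ℝ → ℝ} {A : ℝ} (h : ∫ x in Ioo a b, P.interp g x ≤ A) :
    ∃ i, g (P.node i) ≤ A / (b - a) + 1 := by
  by_contra! hc
  have h1 : ∫ _ in Ioo a b, (A / (b - a) + 1) ≤ ∫ x in Ioo a b, P.interp g x :=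
    setIntegral_mono_on (integrableOn_const (by simp)) (P.integrableOn_interp g) measurableSet_Ioo
      fun x hx => P.le_interp (fun i => (hc i).le) hx
  have hpos := sub_pos.2 hab
  rw [setIntegral_const, Real.volume_real_Ioo_of_le hab.le, smul_eq_mul, mul_add,
    mul_div_cancel₀ _ hpos.ne'] at h1
  linarith

theorem exists_node_near {x : ℝ} (hx : x ∈ Ioo a b) : ∃ i, |P.node i - x| ≤ P.mesh :=
  let ⟨i, _, hi, _⟩ := P.exists_interp_eq hx
  ⟨i, hi⟩

end Partition

/-! ### Admissible curves and the recovery sequence -/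

variable {a b : ℝ} {R l : ℕ} {κ : ℝ} {G : Fin R → Matrix (Fin 3) (Fin 3) ℝ}
  {L : H2 a b →L[ℝ] EuclideanSpace ℝ (Fin l)} {β : EuclideanSpace ℝ (Fin l)}

theorem norm_slope_of_mem_admissible (hab : a < b) {v : H2 a b} (hv : v ∈ admissible L β) {x : ℝ}
    (hx : x ∈ Icc a b) : ‖v.slope x‖ = 1 := by
  refine eqOn_Icc_of_ae_eq_Ioo (g := fun _ => (1 : ℝ)) hab ?_ (v.continuousOn_slope hab).norm
    continuousOn_const hx
  filter_upwards [hv.1, v.d1_ae_eq hab] with y h1 h2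
  rw [← h2, h1]

theorem potential_val_of_mem_admissibleIn (hab : a < b) {v : H2 a b} (hv : v ∈ admissibleIn G L β)
    {x : ℝ} (hx : x ∈ Icc a b) : potential G (v.val x) = 0 := by
  refine eqOn_Icc_of_ae_eq_Ioo (f := fun x => potential G (v.val x)) (g := fun _ => (0 : ℝ)) hab ?_
    ((continuous_potential G).comp_continuousOn (v.continuousOn_val hab)) continuousOn_const hx
  filter_upwards [hv.2, v.fn_ae_eq hab] with y h1 h2
  rw [← h2, potential_eq_zero_iff]
  exact h1

theorem map_eq_of_boundary_eq (hab : a < b) (hL : IsBoundaryOperator L) {u v : H2 a b}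
    (ha : u.val a = v.val a) (hb : u.val b = v.val b) (ha' : u.slope a = v.slope a)
    (hb' : u.slope b = v.slope b) : L u = L v := by
  have hma : a ∈ Icc a b := left_mem_Icc.2 hab.le
  have hmb : b ∈ Icc a b := right_mem_Icc.2 hab.le
  have hrep := (u - v).isC1Rep_val hab
  rw [← sub_eq_zero, ← map_sub]
  refine hL (u - v) _ hrep ?_ ?_ ?_ ?_
  · rw [H2.val_sub_apply hab _ _ hma, ha, sub_self]
  · rw [H2.val_sub_apply hab _ _ hmb, hb, sub_self]
  · rw [hrep.derivWithin_eq hab hma, H2.slope_sub_apply hab _ _ hma, ha', sub_self]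
  · rw [hrep.derivWithin_eq hab hmb, H2.slope_sub_apply hab _ _ hmb, hb', sub_self]

/-- The recovery step: the Hermite interpolant inherits all nodal data of `v`, hence admissibility
and zero penalty, and projection does not increase the bending term. -/
theorem exists_discreteEnergy_le (hab : a < b) (hκ : 0 < κ) (hL : IsBoundaryOperator L)
    (P : Partition a b) (ε : ℝ) {v : H2 a b} (hv : v ∈ admissibleIn G L β) :
    ∃ s : H2 a b, discreteEnergy κ G L β P ε s ≤ ((κ / 2 * ‖v.d2‖ ^ 2 : ℝ) : EReal) := by
  obtain ⟨s, hs, hle, hnode⟩ := H2.exists_spline_interpolant hab P v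
  have hna := hnode 0
  have hnb := hnode (Fin.last _)
  rw [P.node_zero] at hna
  rw [P.node_last] at hnb
  have hmem : s ∈ discreteAdmissible P L β := by
    refine ⟨hs, fun i => ?_, ?_⟩
    · rw [H2.c1Deriv_eq hab s (P.node_mem i), (hnode i).2,
        norm_slope_of_mem_admissible hab hv.1 (P.node_mem i), one_pow]
    · rw [map_eq_of_boundary_eq hab hL hna.1 hnb.1 hna.2 hnb.2, hv.1.2]
  have hz : ∀ i, potential G (s.c1Rep (P.node i)) = 0 := fun i => by
    rw [H2.c1Rep_eq hab s (P.node_mem i), (hnode i).1,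
      potential_val_of_mem_admissibleIn hab hv (P.node_mem i)]
  have hint : ∀ x, P.interp (fun y => potential G (s.c1Rep y)) x = 0 := fun x => by
    simp [Partition.interp, hz]
  refine ⟨s, ?_⟩
  rw [discreteEnergy, if_pos hmem, EReal.coe_le_coe_iff]
  simp only [hint, integral_zero, mul_zero, add_zero]
  rw [L2.integral_norm_sq]
  gcongr

/-- The recovery bound makes the infimum plus `δ` less than +∞, which forces `u` into 𝒜_h and turns
the extended-real inequality into a real one. -/
theorem energy_le_of_almost_minimizer (hab : a < b) (hκ : 0 < κ) (hL : IsBoundaryOperator L)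
    {P : Partition a b} {ε δ : ℝ} {u : H2 a b}
    (hu : discreteEnergy κ G L β P ε u ≤ (⨅ v : H2 a b, discreteEnergy κ G L β P ε v) + (δ : EReal))
    {v : H2 a b} (hv : v ∈ admissibleIn G L β) :
    u ∈ discreteAdmissible P L β ∧
      κ / 2 * ‖u.d2‖ ^ 2 + 1 / (2 * ε) * ∫ x in Ioo a b, P.interp (fun y => potential G (u.c1Rep y)) x
        ≤ κ / 2 * ‖v.d2‖ ^ 2 + δ := by
  obtain ⟨s, hs⟩ := exists_discreteEnergy_le hab hκ hL P ε hv
  have h : discreteEnergy κ G L β P ε u ≤ ((κ / 2 * ‖v.d2‖ ^ 2 + δ : ℝ) : EReal) := by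
    rw [EReal.coe_add]
    exact hu.trans (add_le_add_left ((iInf_le _ s).trans hs) _)
  by_cases hmem : u ∈ discreteAdmissible P L β
  · rw [discreteEnergy, if_pos hmem, EReal.coe_le_coe_iff, L2.integral_norm_sq] at h
    exact ⟨hmem, h⟩
  · rw [discreteEnergy, if_neg hmem, top_le_iff] at h
    exact absurd h (EReal.coe_ne_top _)

/-! ### Boundedness of almost minimizers -/

theorem H2.norm_le_add (u : H2 a b) : ‖u‖ ≤ ‖u.fn‖ + ‖u.d1‖ + ‖u.d2‖ := by
  have h : ‖u‖ ^ 2 = ‖u.fn‖ ^ 2 + ‖u.d1‖ ^ 2 + ‖u.d2‖ ^ 2 := by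
    have := PiLp.norm_sq_eq_of_L2 _ u.1
    rwa [Fin.sum_univ_three] at this
  refine (sq_le_sq₀ (norm_nonneg u) (by positivity)).1 ?_
  rw [h]
  nlinarith [norm_nonneg u.fn, norm_nonneg u.d1, norm_nonneg u.d2,
    mul_nonneg (norm_nonneg u.fn) (norm_nonneg u.d1), mul_nonneg (norm_nonneg u.fn) (norm_nonneg u.d2),
    mul_nonneg (norm_nonneg u.d1) (norm_nonneg u.d2)]

theorem H2.norm_slope_le_of_point (u : H2 a b) {m₁ m₂ x₀ x : ℝ} (hx₀ : x₀ ∈ Icc a b)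
    (hx : x ∈ Icc a b) (h₁ : ‖u.slope x₀‖ ≤ m₁) (h₂ : ‖u.d2‖ ≤ m₂) :
    ‖u.slope x‖ ≤ m₁ + Real.sqrt (b - a) * m₂ := by
  have h3 : |x - x₀| ≤ b - a := abs_le.2 ⟨by linarith [hx.1, hx₀.2], by linarith [hx.2, hx₀.1]⟩
  have h4 : ‖u.slope x - u.slope x₀‖ ≤ Real.sqrt (b - a) * m₂ :=
    (u.norm_slope_sub_le hx₀ hx).trans (by gcongr)
  have h5 := norm_add_le (u.slope x₀) (u.slope x - u.slope x₀)
  rw [add_sub_cancel] at h5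
  linarith

/-- The constant does not depend on the points `x₀`, `x₁`, which will be nodes of varying
partitions. -/
theorem H2.exists_norm_le (hab : a < b) (m₀ m₁ m₂ : ℝ) :
    ∃ C : ℝ, ∀ u : H2 a b, ∀ x₀ ∈ Icc a b, ∀ x₁ ∈ Icc a b, ‖u.val x₀‖ ≤ m₀ → ‖u.slope x₁‖ ≤ m₁ →
      ‖u.d2‖ ≤ m₂ → ‖u‖ ≤ C := by
  -- This is √(b − a), in the form produced by `Lp.norm_le_of_ae_bound`.
  set K : ℝ := (measureUnivNNReal (volume.restrict (Ioo a b)) : ℝ) ^ (2 : ENNReal).toReal⁻¹ with hK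
  refine ⟨K * (m₀ + (m₁ + Real.sqrt (b - a) * m₂) * (b - a)) + K * (m₁ + Real.sqrt (b - a) * m₂) + m₂,
    fun u x₀ hx₀ x₁ hx₁ h0 h1 h2 => ?_⟩
  set M := m₁ + Real.sqrt (b - a) * m₂ with hM
  have hs : ∀ x ∈ Icc a b, ‖u.slope x‖ ≤ M := fun x hx => u.norm_slope_le_of_point hx₁ hx h1 h2
  have hM0 : 0 ≤ M := (norm_nonneg _).trans (hs _ hx₀)
  have hv : ∀ x ∈ Icc a b, ‖u.val x‖ ≤ m₀ + M * (b - a) := by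
    intro x hx
    have h3 : |x - x₀| ≤ b - a := abs_le.2 ⟨by linarith [hx.1, hx₀.2], by linarith [hx.2, hx₀.1]⟩
    have h4 := (u.norm_val_sub_le hab hs hx₀ hx).trans (mul_le_mul_of_nonneg_left h3 hM0)
    have h5 := norm_add_le (u.val x₀) (u.val x - u.val x₀)
    rw [add_sub_cancel] at h5
    linarith
  have hm0 : 0 ≤ m₀ + M * (b - a) := (norm_nonneg _).trans (hv _ hx₀)
  have e0 : ‖u.fn‖ ≤ K * (m₀ + M * (b - a)) := Lp.norm_le_of_ae_bound hm0 (by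
    filter_upwards [u.fn_ae_eq hab, ae_restrict_mem measurableSet_Ioo] with x hx hxI
    rw [hx]
    exact hv x (Ioo_subset_Icc_self hxI))
  have e1 : ‖u.d1‖ ≤ K * M := Lp.norm_le_of_ae_bound hM0 (by
    filter_upwards [u.d1_ae_eq hab, ae_restrict_mem measurableSet_Ioo] with x hx hxI
    rw [hx]
    exact hs x (Ioo_subset_Icc_self hxI))
  linarith [u.norm_le_add]

theorem norm_slope_node (hab : a < b) {P : Partition a b} {u : H2 a b}
    (hu : u ∈ discreteAdmissible P L β) (i : Fin (P.N + 1)) : ‖u.slope (P.node i)‖ = 1 := by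
  have h := hu.2.1 i
  rw [H2.c1Deriv_eq hab u (P.node_mem i)] at h
  exact (pow_eq_one_iff_of_nonneg (norm_nonneg _) two_ne_zero).1 h

theorem interp_c1Rep_eq (hab : a < b) (P : Partition a b) (u : H2 a b) :
    P.interp (fun y => potential G (u.c1Rep y)) = P.interp (fun y => potential G (u.val y)) := by
  have h : ∀ i, u.c1Rep (P.node i) = u.val (P.node i) := fun i => u.c1Rep_eq hab (P.node_mem i)
  ext x
  simp only [Partition.interp, h]

/-- The bound is uniform in the partition. Under the first alternative, the coercivity estimate
applies to u − v, which lies in the kernel of `L`. If D is bounded, some node has a controlled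
potential, hence a controlled position, and the slope has norm 1 there. -/
theorem exists_norm_le_of_energy_le (hab : a < b) (hκ : 0 < κ) {v : H2 a b}
    (hv : v ∈ admissibleIn G L β)
    (hcoer : (∃ c : ℝ, 0 < c ∧ ∀ v : H2 a b, L v = 0 → ‖v‖ ≤ c * ‖v.d2‖) ∨
      Bornology.IsBounded (confinement G)) (m A : ℝ) :
    ∃ C : ℝ, ∀ (P : Partition a b) (u : H2 a b), u ∈ discreteAdmissible P L β →
      κ / 2 * ‖u.d2‖ ^ 2 ≤ m →
      ∫ x in Ioo a b, P.interp (fun y => potential G (u.val y)) x ≤ A → ‖u‖ ≤ C := by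
  have hd2 : ∀ u : H2 a b, κ / 2 * ‖u.d2‖ ^ 2 ≤ m → ‖u.d2‖ ≤ Real.sqrt (2 * m / κ) := by
    intro u hu
    refine Real.le_sqrt_of_sq_le ?_
    rw [le_div_iff₀ hκ]
    linarith
  rcases hcoer with ⟨c, hc, hcoer⟩ | hbdd
  · refine ⟨c * (Real.sqrt (2 * m / κ) + ‖v.d2‖) + ‖v‖, fun P u hu hm _ => ?_⟩
    have h1 := hcoer (u - v) (by rw [map_sub, hu.2.2, hv.1.2, sub_self])
    have h2 : ‖(u - v).d2‖ ≤ Real.sqrt (2 * m / κ) + ‖v.d2‖ :=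
      (norm_sub_le u.d2 v.d2).trans (by gcongr; exact hd2 u hm)
    have h3 := norm_add_le (u - v) v
    rw [sub_add_cancel] at h3
    linarith [mul_le_mul_of_nonneg_left h2 hc.le]
  · obtain ⟨M, hM⟩ := hbdd.exists_norm_le
    obtain ⟨C, hC⟩ := H2.exists_norm_le hab ((1 + Real.sqrt (2 * (A / (b - a) + 1))) * M) 1
      (Real.sqrt (2 * m / κ))
    refine ⟨C, fun P u hu hm hA => ?_⟩
    obtain ⟨i, hi⟩ := P.exists_node_le hab hA
    exact hC u _ (P.node_mem i) _ (P.node_mem i) (norm_le_of_potential_le G hM hi)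
      (norm_slope_node hab hu i).le (hd2 u hm)

/-! ### Identification of weak limits -/

/-- In a finite-dimensional target weak convergence is norm convergence, coordinate by coordinate.
This is applied to point evaluations and to `L`. -/
theorem WeakConv.tendsto {u : ℕ → H2 a b} {u₀ : H2 a b} (h : WeakConv u u₀) {k : ℕ}
    (T : H2 a b →L[ℝ] EuclideanSpace ℝ (Fin k)) : Tendsto (fun n => T (u n)) atTop (𝓝 (T u₀)) := by
  have h1 : Tendsto (fun n => (T (u n)).ofLp) atTop (𝓝 (T u₀).ofLp) :=
    tendsto_pi_nhds.2 fun i => h ((EuclideanSpace.proj i).comp T)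
  exact ((PiLp.continuous_toLp 2 _).tendsto _).comp h1

/-- The second derivative as a bounded operator. -/
def H2.d2L (a b : ℝ) : H2 a b →L[ℝ] L2 a b :=
  (PiLp.proj 2 (fun _ : Fin 3 => L2 a b) 2).comp (Sobolev 2 a b).subtypeL

theorem tendsto_of_dist_le_mesh {P : ℕ → Partition a b}
    (hP : Tendsto (fun n => (P n).mesh) atTop (𝓝 0)) {x : ℝ} {y : ℕ → ℝ}
    (hy : ∀ n, |y n - x| ≤ (P n).mesh) : Tendsto (fun n => |y n - x|) atTop (𝓝 0) :=
  squeeze_zero (fun _ => abs_nonneg _) hy hP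

/-- The uniform ½-Hölder bound allows the evaluation point to move with `n`; this is needed because
the length constraint holds only at nodes. -/
theorem WeakConv.tendsto_slope (hab : a < b) {u : ℕ → H2 a b} {u₀ : H2 a b} (h : WeakConv u u₀)
    {m : ℝ} (hm : ∀ n, ‖(u n).d2‖ ≤ m) {x : ℝ} (hx : x ∈ Icc a b) {y : ℕ → ℝ}
    (hy : ∀ n, y n ∈ Icc a b) (hyx : Tendsto (fun n => |y n - x|) atTop (𝓝 0)) :
    Tendsto (fun n => (u n).slope (y n)) atTop (𝓝 (u₀.slope x)) := by
  have h1 : Tendsto (fun n => (u n).slope x) atTop (𝓝 (u₀.slope x)) := h.tendsto (H2.slopeL hab hx)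
  have h2 : Tendsto (fun n => (u n).slope (y n) - (u n).slope x) atTop (𝓝 0) := by
    refine squeeze_zero_norm (a := fun n => Real.sqrt |y n - x| * m) (fun n =>
      ((u n).norm_slope_sub_le hx (hy n)).trans (by gcongr; exact hm n)) ?_
    have := ((Real.continuous_sqrt.tendsto 0).comp hyx).mul_const m
    simpa using this
  simpa using h1.add h2

theorem WeakConv.tendsto_val (hab : a < b) {u : ℕ → H2 a b} {u₀ : H2 a b} (h : WeakConv u u₀)
    {m : ℝ} (hm : ∀ n, ∀ x ∈ Icc a b, ‖(u n).slope x‖ ≤ m) {x : ℝ} (hx : x ∈ Icc a b) {y : ℕ → ℝ}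
    (hy : ∀ n, y n ∈ Icc a b) (hyx : Tendsto (fun n => |y n - x|) atTop (𝓝 0)) :
    Tendsto (fun n => (u n).val (y n)) atTop (𝓝 (u₀.val x)) := by
  have h1 : Tendsto (fun n => (u n).val x) atTop (𝓝 (u₀.val x)) := h.tendsto (H2.valL hab hx)
  have h2 : Tendsto (fun n => (u n).val (y n) - (u n).val x) atTop (𝓝 0) := by
    refine squeeze_zero_norm (a := fun n => m * |y n - x|) (fun n =>
      (u n).norm_val_sub_le hab (hm n) hx (hy n)) ?_
    simpa using hyx.const_mul m
  simpa using h1.add h2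

/-- The weights need not converge, since both sequences have the same limit. -/
theorem tendsto_convexCombination {p q θ : ℕ → ℝ} {c : ℝ} (hθ : ∀ n, θ n ∈ Icc (0 : ℝ) 1)
    (hp : Tendsto p atTop (𝓝 c)) (hq : Tendsto q atTop (𝓝 c)) :
    Tendsto (fun n => (1 - θ n) * p n + θ n * q n) atTop (𝓝 c) := by
  rw [tendsto_iff_norm_sub_tendsto_zero] at hp hq ⊢
  refine squeeze_zero (fun _ => norm_nonneg _) (fun n => ?_) (by simpa using hp.add hq)
  have e : (1 - θ n) * p n + θ n * q n - c = (1 - θ n) * (p n - c) + θ n * (q n - c) := by ring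
  rw [e]
  refine (norm_add_le _ _).trans (add_le_add ?_ ?_)
  · rw [norm_mul, Real.norm_of_nonneg (sub_nonneg.2 (hθ n).2)]
    exact mul_le_of_le_one_left (norm_nonneg _) (by linarith [(hθ n).1])
  · rw [norm_mul, Real.norm_of_nonneg (hθ n).1]
    exact mul_le_of_le_one_left (norm_nonneg _) (hθ n).2

theorem mem_admissibleIn_of_weakConv (hab : a < b) {P : ℕ → Partition a b}
    (hP : Tendsto (fun n => (P n).mesh) atTop (𝓝 0)) {u : ℕ → H2 a b} {u₀ : H2 a b}
    (h : WeakConv u u₀) (hu : ∀ n, u n ∈ discreteAdmissible (P n) L β) {m : ℝ}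
    (hm : ∀ n, ‖(u n).d2‖ ≤ m)
    (hV : Tendsto (fun n => ∫ x in Ioo a b, (P n).interp (fun y => potential G ((u n).val y)) x)
      atTop (𝓝 0)) : u₀ ∈ admissibleIn G L β := by
  have ha : a ∈ Icc a b := left_mem_Icc.2 hab.le
  have hs : ∀ n, ∀ x ∈ Icc a b, ‖(u n).slope x‖ ≤ 1 + Real.sqrt (b - a) * m := fun n x hx =>
    (u n).norm_slope_le_of_point ((P n).node_mem 0) hx (norm_slope_node hab (hu n) 0).le (hm n)
  refine ⟨⟨?_, ?_⟩, ?_⟩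
  · filter_upwards [u₀.d1_ae_eq hab, ae_restrict_mem measurableSet_Ioo] with x hx hxI
    rw [hx]
    choose i hi using fun n => (P n).exists_node_near hxI
    have ht := (h.tendsto_slope hab hm (Ioo_subset_Icc_self hxI) (fun n => (P n).node_mem (i n))
      (tendsto_of_dist_le_mesh hP hi)).norm
    simp only [fun n => norm_slope_node hab (hu n) (i n)] at ht
    exact tendsto_nhds_unique ht tendsto_const_nhds
  · have ht := h.tendsto L
    simp only [fun n => (hu n).2.2] at ht
    exact tendsto_nhds_unique ht tendsto_const_nhds
  · have hlim : ∀ x ∈ Ioo a b, Tendsto (fun n => (P n).interp (fun y => potential G ((u n).val y)) x)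
        atTop (𝓝 (potential G (u₀.val x))) := by
      intro x hxI
      choose i j hi hj θ hθ hint using fun n => (P n).exists_interp_eq hxI
      simp only [hint]
      have key : ∀ k : ∀ n, Fin ((P n).N + 1), (∀ n, |(P n).node (k n) - x| ≤ (P n).mesh) →
          Tendsto (fun n => potential G ((u n).val ((P n).node (k n)))) atTop
            (𝓝 (potential G (u₀.val x))) := fun k hk =>
        ((continuous_potential G).tendsto _).comp (h.tendsto_val hab hs (Ioo_subset_Icc_self hxI)
          (fun n => (P n).node_mem (k n)) (tendsto_of_dist_le_mesh hP hk))
      exact tendsto_convexCombination hθ (key i hi) (key j hj)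
    have hcont : ContinuousOn (fun x => potential G (u₀.val x)) (Icc a b) :=
      (continuous_potential G).comp_continuousOn (u₀.continuousOn_val hab)
    -- The interpolated potentials are nonnegative and converge pointwise, so Fatou's lemma needs no
    -- dominating function.
    have hfatou : ∫⁻ x in Ioo a b, ENNReal.ofReal (potential G (u₀.val x)) ≤ 0 := by
      calc ∫⁻ x in Ioo a b, ENNReal.ofReal (potential G (u₀.val x))
          = ∫⁻ x in Ioo a b, liminf (fun n => ENNReal.ofReal
              ((P n).interp (fun y => potential G ((u n).val y)) x)) atTop := by
            refine setLIntegral_congr_fun measurableSet_Ioo fun x hx => ?_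
            exact ((ENNReal.continuous_ofReal.tendsto _).comp (hlim x hx)).liminf_eq.symm
        _ ≤ liminf (fun n => ∫⁻ x in Ioo a b, ENNReal.ofReal
              ((P n).interp (fun y => potential G ((u n).val y)) x)) atTop :=
            lintegral_liminf_le fun n => ((P n).continuous_interp _).measurable.ennreal_ofReal
        _ = liminf (fun n => ENNReal.ofReal
              (∫ x in Ioo a b, (P n).interp (fun y => potential G ((u n).val y)) x)) atTop := by
            congr 1
            ext n
            refine (ofReal_integral_eq_lintegral_ofReal ((P n).integrableOn_interp _) ?_).symm
            filter_upwards [ae_restrict_mem measurableSet_Ioo] with x hx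
            exact (P n).le_interp (fun _ => potential_nonneg G _) hx
        _ = 0 := by
            have := ((ENNReal.continuous_ofReal.tendsto _).comp hV).liminf_eq
            rwa [ENNReal.ofReal_zero] at this
    have hae := (lintegral_eq_zero_iff' (((hcont.mono Ioo_subset_Icc_self).aemeasurable
      measurableSet_Ioo).ennreal_ofReal)).1 (le_antisymm hfatou zero_le)
    filter_upwards [hae, u₀.fn_ae_eq hab] with x hx hx'
    rw [hx', ← potential_eq_zero_iff]
    exact le_antisymm (ENNReal.ofReal_eq_zero.1 hx) (potential_nonneg G _)

/-- Expanding ‖u₀'' − u_n''‖² ≥ 0 gives ‖u_n''‖² ≥ 2⟨u₀'', u_n''⟩ − ‖u₀''‖², whose right side is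
affine in u_n'' and tends to ‖u₀''‖². -/
theorem WeakConv.energy_le {u : ℕ → H2 a b} {u₀ : H2 a b} (hκ : 0 < κ) (h : WeakConv u u₀)
    {δ : ℕ → ℝ} (hδ : Tendsto δ atTop (𝓝 0)) {m : ℝ}
    (hm : ∀ n, κ / 2 * ‖(u n).d2‖ ^ 2 ≤ m + δ n) : κ / 2 * ‖u₀.d2‖ ^ 2 ≤ m := by
  have h1 : Tendsto (fun n => inner ℝ u₀.d2 (u n).d2) atTop (𝓝 (inner ℝ u₀.d2 u₀.d2)) :=
    h ((innerSL ℝ u₀.d2).comp (H2.d2L a b))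
  rw [real_inner_self_eq_norm_sq] at h1
  have h2 := ((h1.const_mul 2).sub_const (‖u₀.d2‖ ^ 2)).const_mul (κ / 2)
  have h3 := hδ.const_add m
  rw [add_zero] at h3
  have h4 := le_of_tendsto_of_tendsto' h2 h3 fun n => by
    refine le_trans ?_ (hm n)
    gcongr
    have h5 := norm_sub_sq_real u₀.d2 (u n).d2
    nlinarith [sq_nonneg ‖u₀.d2 - (u n).d2‖]
  linarith

end

end ConfinedElastica

/-! ### Weak accumulation of almost minimizers at minimizers -/

theorem mainTheorem2 {a b : ℝ} (hab : a < b) {κ : ℝ} (hκ : 0 < κ)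
    {R : ℕ} (G : Fin R → Matrix (Fin 3) (Fin 3) ℝ) (hG : ∀ r, (G r).PosSemidef)
    {l : ℕ} (L : H2 a b →L[ℝ] EuclideanSpace ℝ (Fin l)) (hL : IsBoundaryOperator L)
    (β : EuclideanSpace ℝ (Fin l))
    (hne : (admissibleIn G L β).Nonempty)
    (hreg : ∀ u : H2 a b, IsBendMinimizer κ G L β u → u.MemH3)
    (hcoer : (∃ c : ℝ, 0 < c ∧ ∀ v : H2 a b, L v = 0 → ‖v‖ ≤ c * ‖v.d2‖) ∨
      Bornology.IsBounded (confinement G))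
    (P : ℕ → Partition a b) (hP : Tendsto (fun n => (P n).mesh) atTop (𝓝 0))
    (ε : ℕ → ℝ) (hεpos : ∀ n, 0 < ε n) (hε : Tendsto ε atTop (𝓝 0))
    (u : ℕ → H2 a b) (δ : ℕ → ℝ) (hδ : Tendsto δ atTop (𝓝 0))
    (hu : ∀ n, discreteEnergy κ G L β (P n) (ε n) (u n) ≤
      (⨅ v : H2 a b, discreteEnergy κ G L β (P n) (ε n) v) + (δ n : EReal)) :
    (∀ φ : ℕ → ℕ, StrictMono φ →
      ∃ ψ : ℕ → ℕ, StrictMono ψ ∧ ∃ u₀ : H2 a b, WeakConv (fun n => u (φ (ψ n))) u₀) ∧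
    (∀ φ : ℕ → ℕ, StrictMono φ → ∀ u₀ : H2 a b, WeakConv (fun n => u (φ n)) u₀ →
      IsBendMinimizer κ G L β u₀) := by
  obtain ⟨v, hv⟩ := hne
  have hkey : ∀ n, ∀ w ∈ admissibleIn G L β, u n ∈ discreteAdmissible (P n) L β ∧
      κ / 2 * ‖(u n).d2‖ ^ 2 + 1 / (2 * ε n) *
        ∫ x in Ioo a b, (P n).interp (fun y => potential G ((u n).val y)) x
        ≤ κ / 2 * ‖w.d2‖ ^ 2 + δ n := fun n w hw => by
    rw [← interp_c1Rep_eq hab]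
    exact energy_le_of_almost_minimizer hab hκ hL (hu n) hw
  have hmem : ∀ n, u n ∈ discreteAdmissible (P n) L β := fun n => (hkey n v hv).1
  have hA0 : ∀ n, 0 ≤ ∫ x in Ioo a b, (P n).interp (fun y => potential G ((u n).val y)) x :=
    fun n => (P n).integral_interp_nonneg fun _ => potential_nonneg G _
  -- The competitor stays arbitrary here: the fixed `v` suffices for compactness, but minimality
  -- needs every `w`.
  have hbend : ∀ n, ∀ w ∈ admissibleIn G L β,
      κ / 2 * ‖(u n).d2‖ ^ 2 ≤ κ / 2 * ‖w.d2‖ ^ 2 + δ n := fun n w hw => by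
    have h1 : 0 ≤ 1 / (2 * ε n) := by have := hεpos n; positivity
    linarith [(hkey n w hw).2, mul_nonneg h1 (hA0 n)]
  -- Dropping the bending term and multiplying by 2ε_n shows that the penalty integral is of order
  -- ε_n.
  have hpen : ∀ n, ∫ x in Ioo a b, (P n).interp (fun y => potential G ((u n).val y)) x
      ≤ 2 * ε n * (κ / 2 * ‖v.d2‖ ^ 2 + δ n) := fun n => by
    have h1 : 0 < 2 * ε n := by have := hεpos n; positivity
    have h2 : 0 ≤ κ / 2 * ‖(u n).d2‖ ^ 2 := by positivity
    have h3 := (hkey n v hv).2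
    rw [one_div_mul_eq_div] at h3
    have h4 := (div_le_iff₀ h1).1 ((le_add_of_nonneg_left h2).trans h3)
    rwa [mul_comm] at h4
  have hpen0 : Tendsto (fun n => 2 * ε n * (κ / 2 * ‖v.d2‖ ^ 2 + δ n)) atTop (𝓝 0) := by
    have := (hε.const_mul 2).mul (hδ.const_add (κ / 2 * ‖v.d2‖ ^ 2))
    simpa using this
  have hV : Tendsto (fun n => ∫ x in Ioo a b,
      (P n).interp (fun y => potential G ((u n).val y)) x) atTop (𝓝 0) :=
    squeeze_zero hA0 hpen hpen0
  -- Convergent sequences are bounded, so the energy and penalty bounds hold uniformly in `n`.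
  obtain ⟨Δ, hΔ⟩ := hδ.bddAbove_range
  obtain ⟨A, hA⟩ := hV.bddAbove_range
  have hbd : ∀ n, κ / 2 * ‖(u n).d2‖ ^ 2 ≤ κ / 2 * ‖v.d2‖ ^ 2 + Δ := fun n =>
    (hbend n v hv).trans (by have := hΔ (mem_range_self n); gcongr)
  obtain ⟨C, hC⟩ := exists_norm_le_of_energy_le hab hκ hv hcoer (κ / 2 * ‖v.d2‖ ^ 2 + Δ) A
  have hnorm : ∀ n, ‖u n‖ ≤ C := fun n =>
    hC (P n) (u n) (hmem n) (hbd n) (hA (mem_range_self n))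
  refine ⟨fun φ _ => exists_weak_subseq_limit fun n => hnorm (φ n), fun φ hφ u₀ hw => ?_⟩
  have hφt := hφ.tendsto_atTop
  have hu₀ : u₀ ∈ admissibleIn G L β :=
    mem_admissibleIn_of_weakConv hab (P := fun n => P (φ n)) (hP.comp hφt) hw (fun n => hmem (φ n))
      (fun n => ((u (φ n)).norm_component_le 2).trans (hnorm (φ n))) (hV.comp hφt)
  refine ⟨hu₀, fun w => ?_⟩
  by_cases hwm : w ∈ admissibleIn G L β
  · rw [bendEnergy, if_pos hu₀, bendEnergy, if_pos hwm, EReal.coe_le_coe_iff, L2.integral_norm_sq,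
      L2.integral_norm_sq]
    exact hw.energy_le hκ (hδ.comp hφt) fun n => hbend (φ n) w hwm
  · rw [bendEnergy, bendEnergy, if_neg hwm]
    exact le_top
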